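/- **Theorem.** Let $\mathcal H$ be a finite-dimensional complex Hilbert space and let $\mathcal E:\mathcal B(\mathcal H)\to\mathcal B(\mathcal H)$ be an arbitrary completely positive trace-preserving (CPTP) linear map, not necessarily unital. Let $\mathcal E^\dagger$ be its adjoint for the Hilbert–Schmidt inner product $\langle X,Y\rangle=\mathrm{Tr}(X^\dagger Y)$, and write $\mathrm{Fix}(\mathcal F)=\{X:\mathcal F(X)=X\}$. Let $\mathcal P_0\subseteq\mathcal H$ be the support of $\mathrm{Fix}(\mathcal E)$, i.e. the span of the ranges of all $X$ and $X^\dagger$ with $X\in\mathrm{Fix}(\mathcal E)$, and let $P_0$ be the orthogonal projector onto $\mathcal P_0$. Identify $\mathcal B(\mathcal P_0)$ with $P_0\mathcal B(\mathcal H)P_0$, and let $\mathcal E_{\mathcal P_0}:\mathcal B(\mathcal P_0)\to\mathcal B(\mathcal P_0)$, $\mathcal E_{\mathcal P_0}(X)=P_0\mathcal E(X)P_0$, be the restriction of $\mathcal E$ to $\mathcal P_0$, with Hilbert–Schmidt adjoint $\mathcal E_{\mathcal P_0}^\dagger$. Then: 1. $\mathcal P_0$ is an invariant subspace under $\mathcal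 E$: if $P_0XP_0=X$, then $P_0\,\mathcal E(X)P_0=\mathcal E(X)$. 2. $\mathcal A:=\mathrm{Fix}(\mathcal E_{\mathcal P_0}^\dagger)$ is a matrix algebra: it is a unital subalgebra of $\mathcal B(\mathcal P_0)$ closed under $\dagger$, and there is a unitary identification $\mathcal P_0\cong\bigoplus_k A_k\otimes B_k$ (finitely many $k$; $A_k,B_k$ nonzero finite-dimensional Hilbert spaces) under which $$\mathcal A=\bigoplus_k \mathcal M_{A_k}\otimes 1_{B_k},$$ where $\mathcal M_{A_k}$ is the algebra of all operators on $A_k$. 3. $\mathrm{Fix}(\mathcal E)$ is a distortion of $\mathcal A$: under the same identification there are positive semidefinite operators $\tau_k$ on $B_k$ with $$\mathrm{Fix}(\mathcal E)=\bigoplus_k \mathcal M_{A_k}\otimes\tau_k ,$$ and there is a CPTP map $\mathcal D$ on $\mathcal B(\mathcal P_0)$ with $\mathcal D\big(\bigoplus_k M_k\otimes 1_{B_k}\big)=\bigoplus_k M_k\otimes\tau_k$ for all $M_k\in\mathcal M_{A_k}$, so that $\mathrm{Fix}(\mathcal E)=\mathcal D(\mathcal A)$. 4. $P_0\,\mathrm{Fix}(\mathcal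 E^\dagger)\,P_0=\mathcal A$. -/

import Mathlib

open scoped Kronecker CStarAlgebra ComplexOrder

noncomputable section

namespace QChannel

section Basic

variable {H : Type*} [NormedAddCommGroup H] [InnerProductSpace ℂ H]

/-- The trace of an operator. -/
def tr (X : H →L[ℂ] H) : ℂ := LinearMap.trace ℂ H (X : H →ₗ[ℂ] H)

/-- A linear map on operators is trace preserving. -/
def IsTracePreserving (T : (H →L[ℂ] H) →ₗ[ℂ] (H →L[ℂ] H)) : Prop :=
  ∀ X, tr (T X) = tr X

/-- The fixed points `Fix(T) = {X | T X = X}` of a linear map on operators. -/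
def Fix (T : (H →L[ℂ] H) →ₗ[ℂ] (H →L[ℂ] H)) : Submodule ℂ (H →L[ℂ] H) :=
  LinearMap.eqLocus T LinearMap.id

variable [FiniteDimensional ℂ H] [CompleteSpace H]

/-- The Hilbert-Schmidt adjoint `T†` of a linear map `T` on operators, expanded in the matrix units
`|e i⟩⟨e j|` of an orthonormal basis: its coefficient at `|e i⟩⟨e j|` is
`⟨T |e i⟩⟨e j|, X⟩ = tr ((T |e i⟩⟨e j|)† X)`.  It is characterized, independently of the basis, by
`tr_adjoint_hsAdjoint_comp` below. -/
def hsAdjoint (T : (H →L[ℂ] H) →ₗ[ℂ] (H →L[ℂ] H)) : (H →L[ℂ] H) →ₗ[ℂ] (H →L[ℂ] H) where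
  toFun X := ∑ i, ∑ j,
    tr ((T (InnerProductSpace.rankOne ℂ (stdOrthonormalBasis ℂ H i)
      (stdOrthonormalBasis ℂ H j))).adjoint ∘L X) •
      InnerProductSpace.rankOne ℂ (stdOrthonormalBasis ℂ H i) (stdOrthonormalBasis ℂ H j)
  map_add' X Y := by
    simp [tr, add_smul, Finset.sum_add_distrib]
  map_smul' c X := by
    simp [tr, Finset.smul_sum, mul_smul]

/-- The support of a set of operators: the span of the ranges of all its members and of their
adjoints, i.e. the smallest subspace with projector `P` such that `P X P = X` for all members. -/
def support (S : Set (H →L[ℂ] H)) : Submodule ℂ H :=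
  ⨆ X ∈ S, (X : H →ₗ[ℂ] H).range ⊔ (X.adjoint : H →ₗ[ℂ] H).range

/-- `Π_P X = P X P`, where `P` also denotes the orthogonal projector onto the subspace `P`. -/
def sandwich (P : Submodule ℂ H) (X : H →L[ℂ] H) : H →L[ℂ] H :=
  P.starProjection ∘L X ∘L P.starProjection

/-- `P` is an invariant subspace under `T`: every operator on `P` is sent to an operator on `P`. -/
def IsInvariantSubspace (T : (H →L[ℂ] H) →ₗ[ℂ] (H →L[ℂ] H)) (P : Submodule ℂ H) : Prop :=
  ∀ X, sandwich P X = X → sandwich P (T X) = T X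

/-- The inclusion of `B(P)` into `B(H)` (extension by zero on the orthogonal complement). -/
def embed (P : Submodule ℂ H) : (P →L[ℂ] P) →ₗ[ℂ] (H →L[ℂ] H) where
  toFun X := P.subtypeL ∘L X ∘L P.orthogonalProjectionOnto
  map_add' X Y := by ext; simp
  map_smul' c X := by ext; simp

/-- The compression of `B(H)` onto `B(P)`. -/
def compress (P : Submodule ℂ H) : (H →L[ℂ] H) →ₗ[ℂ] (P →L[ℂ] P) where
  toFun X := P.orthogonalProjectionOnto ∘L X ∘L P.subtypeL
  map_add' X Y := by ext; simp
  map_smul' c X := by ext; simp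

/-- The restriction `Π_P ∘ T ∘ Π_P` of `T` to `P`, as a map on `B(P)`. -/
def restrict (T : (H →L[ℂ] H) →ₗ[ℂ] (H →L[ℂ] H)) (P : Submodule ℂ H) :
    (P →L[ℂ] P) →ₗ[ℂ] (P →L[ℂ] P) :=
  compress P ∘ₗ T ∘ₗ embed P

end Basic

section Blocks

/-- A decomposition `K ≅ ⨁ₖ Aₖ ⊗ Bₖ` of a Hilbert space into finitely many sectors, where
`Aₖ = ℂ^(d k)` and `Bₖ = ℂ^(n k)` are nonzero: a unitary onto the Hilbert space with
orthonormal basis indexed by the triples `(k, a, b)`. -/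
structure SectorDecomposition (K : Type*) [NormedAddCommGroup K] [InnerProductSpace ℂ K] where
  sectors : ℕ
  d : Fin sectors → ℕ
  n : Fin sectors → ℕ
  d_pos : ∀ k, 0 < d k
  n_pos : ∀ k, 0 < n k
  U : K ≃ₗᵢ[ℂ] EuclideanSpace ℂ (Σ k : Fin sectors, Fin (d k) × Fin (n k))

variable {K : Type*} [NormedAddCommGroup K] [InnerProductSpace ℂ K]

namespace SectorDecomposition

/-- The operator on `K` that corresponds to `⨁ₖ M k ⊗ N k`. -/
def op (σ : SectorDecomposition K) (M : ∀ k, Matrix (Fin (σ.d k)) (Fin (σ.d k)) ℂ)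
    (N : ∀ k, Matrix (Fin (σ.n k)) (Fin (σ.n k)) ℂ) : K →L[ℂ] K :=
  (σ.U.symm.toContinuousLinearEquiv : _ →L[ℂ] K) ∘L
    Matrix.toEuclideanCLM (𝕜 := ℂ) (Matrix.blockDiagonal' fun k => M k ⊗ₖ N k) ∘L
    (σ.U.toContinuousLinearEquiv : K →L[ℂ] _)

/-- The set `⨁ₖ M_{Aₖ} ⊗ τₖ` of all operators `⨁ₖ M k ⊗ τ k`, with `τ` fixed. -/
def blockSet (σ : SectorDecomposition K) (τ : ∀ k, Matrix (Fin (σ.n k)) (Fin (σ.n k)) ℂ) :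
    Set (K →L[ℂ] K) :=
  Set.range fun M => σ.op M τ

variable [CompleteSpace K]

/-- `D` is a distortion map for the algebra `⨁ₖ M_{Aₖ} ⊗ 1_{Bₖ}`, with distorting matrices `τ`:
a completely positive trace preserving map that sends `⨁ₖ M k ⊗ 1` to `⨁ₖ M k ⊗ τ k`, where the
positive semidefinite matrices `τ k` do not depend on `M`. -/
def IsDistortionMap (σ : SectorDecomposition K)
    (τ : ∀ k, Matrix (Fin (σ.n k)) (Fin (σ.n k)) ℂ)
    (D : (K →L[ℂ] K) →CP (K →L[ℂ] K)) : Prop :=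
  IsTracePreserving D.toLinearMap ∧ (∀ k, (τ k).PosSemidef) ∧ ∀ M, D (σ.op M 1) = σ.op M τ

end SectorDecomposition

end Blocks

section Facts

variable {H : Type*} [NormedAddCommGroup H] [InnerProductSpace ℂ H]

theorem tr_sum {ι : Type*} (s : Finset ι) (f : ι → H →L[ℂ] H) :
    tr (∑ i ∈ s, f i) = ∑ i ∈ s, tr (f i) := by
  simp [tr]

theorem tr_smul (c : ℂ) (X : H →L[ℂ] H) : tr (c • X) = c * tr X := by
  simp [tr]

theorem tr_comp_comm (X Y : H →L[ℂ] H) : tr (X ∘L Y) = tr (Y ∘L X) :=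
  LinearMap.trace_mul_comm ℂ (X : H →ₗ[ℂ] H) Y

theorem op_eq_sum_rankOne {ι : Type*} [Fintype ι] (b : OrthonormalBasis ι ℂ H) (X : H →L[ℂ] H) :
    X = ∑ i, ∑ j, inner ℂ (b i) (X (b j)) • InnerProductSpace.rankOne ℂ (b i) (b j) := by
  classical
  refine ContinuousLinearMap.coe_injective (b.toBasis.ext fun l => ?_)
  have h := (b.sum_repr' (X (b l))).symm
  simpa [InnerProductSpace.rankOne_apply, b.inner_eq_ite] using h

variable [FiniteDimensional ℂ H]

theorem tr_comp_rankOne (X : H →L[ℂ] H) (x y : H) :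
    tr (X ∘L InnerProductSpace.rankOne ℂ x y) = inner ℂ y (X x) := by
  simp [tr, LinearMap.trace_eq_sum_inner _ (stdOrthonormalBasis ℂ H),
    InnerProductSpace.rankOne_apply, inner_smul_right, OrthonormalBasis.sum_inner_mul_inner]

variable [CompleteSpace H]

theorem tr_adjoint (X : H →L[ℂ] H) : tr X.adjoint = star (tr X) := by
  simp [tr, LinearMap.trace_eq_sum_inner _ (stdOrthonormalBasis ℂ H),
    ContinuousLinearMap.adjoint_inner_right]

theorem hsAdjoint_apply (T : (H →L[ℂ] H) →ₗ[ℂ] (H →L[ℂ] H)) (X : H →L[ℂ] H) :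
    hsAdjoint T X = ∑ i, ∑ j,
      tr ((T (InnerProductSpace.rankOne ℂ (stdOrthonormalBasis ℂ H i)
        (stdOrthonormalBasis ℂ H j))).adjoint ∘L X) •
        InnerProductSpace.rankOne ℂ (stdOrthonormalBasis ℂ H i) (stdOrthonormalBasis ℂ H j) :=
  rfl

/-- The defining property of the Hilbert-Schmidt adjoint: `⟨T† X, Y⟩ = ⟨X, T Y⟩` for the
inner product `⟨X, Y⟩ = tr (X† Y)`. -/
theorem tr_adjoint_hsAdjoint_comp (T : (H →L[ℂ] H) →ₗ[ℂ] (H →L[ℂ] H)) (X Y : H →L[ℂ] H) :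
    tr ((hsAdjoint T X).adjoint ∘L Y) = tr (X.adjoint ∘L T Y) := by
  have h1 : tr (Y.adjoint ∘L hsAdjoint T X) = ∑ i, ∑ j,
      tr ((T (InnerProductSpace.rankOne ℂ (stdOrthonormalBasis ℂ H i)
        (stdOrthonormalBasis ℂ H j))).adjoint ∘L X) *
      inner ℂ (stdOrthonormalBasis ℂ H j) (Y.adjoint (stdOrthonormalBasis ℂ H i)) := by
    simp only [hsAdjoint_apply, ContinuousLinearMap.comp_finsetSum,
      ContinuousLinearMap.comp_smul, tr_sum, tr_smul, tr_comp_rankOne]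
  have h2 : tr (X.adjoint ∘L T Y) = ∑ i, ∑ j,
      inner ℂ (stdOrthonormalBasis ℂ H i) (Y (stdOrthonormalBasis ℂ H j)) *
      tr (X.adjoint ∘L T (InnerProductSpace.rankOne ℂ (stdOrthonormalBasis ℂ H i)
        (stdOrthonormalBasis ℂ H j))) := by
    conv_lhs => rw [op_eq_sum_rankOne (stdOrthonormalBasis ℂ H) Y]
    simp only [map_sum, map_smul, ContinuousLinearMap.comp_finsetSum,
      ContinuousLinearMap.comp_smul, tr_sum, tr_smul]
  have h3 : tr ((hsAdjoint T X).adjoint ∘L Y) = star (tr (Y.adjoint ∘L hsAdjoint T X)) := by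
    rw [← tr_adjoint, ContinuousLinearMap.adjoint_comp, ContinuousLinearMap.adjoint_adjoint]
  rw [h3, h1, h2, star_sum]
  refine Finset.sum_congr rfl fun i _ => ?_
  rw [star_sum]
  refine Finset.sum_congr rfl fun j _ => ?_
  rw [star_mul', ← tr_adjoint, ContinuousLinearMap.adjoint_comp,
    ContinuousLinearMap.adjoint_adjoint, ContinuousLinearMap.adjoint_inner_right, mul_comm]
  congr 1
  exact inner_conj_symm _ _

/-- If `T ρ = ∑ᵢ Eᵢ ρ Eᵢ†` then `T† X = ∑ᵢ Eᵢ† X Eᵢ`. -/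
theorem hsAdjoint_of_kraus {ι : Type*} [Fintype ι] (T : (H →L[ℂ] H) →ₗ[ℂ] (H →L[ℂ] H))
    (E : ι → H →L[ℂ] H) (hT : ∀ ρ, T ρ = ∑ i, E i ∘L ρ ∘L (E i).adjoint) (X : H →L[ℂ] H) :
    hsAdjoint T X = ∑ i, (E i).adjoint ∘L X ∘L E i := by
  have key : ∀ Y : H →L[ℂ] H, tr ((hsAdjoint T X).adjoint ∘L Y) =
      tr ((∑ i, (E i).adjoint ∘L X ∘L E i).adjoint ∘L Y) := by
    intro Y
    rw [tr_adjoint_hsAdjoint_comp, hT]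
    simp only [map_sum, ContinuousLinearMap.comp_finsetSum, ContinuousLinearMap.finsetSum_comp,
      tr_sum, ContinuousLinearMap.adjoint_comp, ContinuousLinearMap.adjoint_adjoint]
    refine Finset.sum_congr rfl fun i _ => ?_
    rw [← ContinuousLinearMap.comp_assoc, ← ContinuousLinearMap.comp_assoc, tr_comp_comm]
    simp only [ContinuousLinearMap.comp_assoc]
  ext y
  refine ext_inner_right ℂ fun x => ?_
  have := key (InnerProductSpace.rankOne ℂ x y)
  rwa [tr_comp_rankOne, tr_comp_rankOne, ContinuousLinearMap.adjoint_inner_right,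
    ContinuousLinearMap.adjoint_inner_right] at this

end Facts

end QChannel

end

/-!
An invariant state `ρ` of maximal rank supports `P₀`, and since `E ρ = ρ` every Kraus operator of
`E` maps the range of `ρ` into itself; so `E` compresses to a channel on `P₀` with a faithful
invariant state. For such a channel the trace of `ρ` against
`E†(X† X) - X† X = ∑ᵢ [Kᵢ, X]† [Kᵢ, X]` vanishes when `E† X = X`, so the fixed points of `E†` are
the commutant of the Kraus operators and their adjoints. Splitting `P₀` into irreducible subspaces
and collecting the isomorphic ones puts this commutant in the form `⨁ₖ M_{Aₖ} ⊗ 1`.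

The fixed points of `E` form a bimodule over the commutant. Averaging `ρ` with the matrix units of
the `Aₖ` gives a fixed point `⨁ₖ 1 ⊗ τₖ`, hence `⨁ₖ M_{Aₖ} ⊗ τₖ ⊆ Fix E`, and equality follows
because `E` and `E†` have fixed point spaces of the same dimension. Finally, the compression to `P₀`
is injective on the fixed points of `E†`: an element of its kernel is annihilated by `Fix E`, hence
lies in the range of `E† - 1`, and a unital positive map has no Jordan block at the eigenvalue `1`.
-/

noncomputable section

namespace QChannel

open InnerProductSpace (rankOne)

-- `CStarAlgebra.nonneg_iff_eq_star_mul_self` is stated for algebras with a functional calculus, and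
-- the instances it asks for are not found on `CStarMatrix`.
theorem exists_eq_star_mul_self {A : Type*} [NonUnitalCStarAlgebra A] [PartialOrder A]
    [StarOrderedRing A] {a : A} (ha : 0 ≤ a) : ∃ b, a = star b * b :=
  CStarAlgebra.nonneg_iff_eq_star_mul_self.1 ha

section KrausMap

variable {A ι : Type*} [Ring A] [StarRing A] [Algebra ℂ A] [Fintype ι]

/-- The linear map `X ↦ ∑ᵢ Kᵢ X Kᵢ†` with Kraus operators `K`. -/
def krausMap (K : ι → A) : A →ₗ[ℂ] A where
  toFun X := ∑ i, K i * X * star (K i)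
  map_add' X Y := by simp only [mul_add, add_mul, Finset.sum_add_distrib]
  map_smul' c X := by simp only [mul_smul_comm, smul_mul_assoc, Finset.smul_sum, RingHom.id_apply]

theorem krausMap_apply (K : ι → A) (X : A) : krausMap K X = ∑ i, K i * X * star (K i) := rfl

theorem krausMap_monotone [PartialOrder A] [StarOrderedRing A] (K : ι → A) :
    Monotone (krausMap K) := fun _ _ h =>
  Finset.sum_le_sum fun i _ => star_right_conjugate_le_conjugate h (K i)

theorem map_krausMap_eq_krausMap_diagonal {n : Type*} [Fintype n] [DecidableEq n] (K : ι → A)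
    (M : CStarMatrix n n A) :
    M.map (krausMap K) = krausMap
      (fun i => (CStarMatrix.ofMatrix (Matrix.diagonal fun _ => K i) : CStarMatrix n n A)) M := by
  refine CStarMatrix.ext fun a b => ?_
  refine .trans ?_ (Matrix.sum_apply a b Finset.univ _).symm
  refine Finset.sum_congr rfl fun i _ => ?_
  set C : CStarMatrix n n A := CStarMatrix.ofMatrix (Matrix.diagonal fun _ => K i)
  have hC a c : C a c = if a = c then K i else 0 := Matrix.diagonal_apply _ _ _
  change _ = (C * M * star C) a b
  simp only [CStarMatrix.mul_apply, CStarMatrix.star_apply, hC, apply_ite star, star_zero, ite_mul,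
    mul_ite, zero_mul, mul_zero, Finset.sum_ite_eq, Finset.mem_univ, if_true]

end KrausMap

section KrausCP

variable {A ι : Type*} [CStarAlgebra A] [PartialOrder A] [StarOrderedRing A] [Fintype ι]

/-- `krausMap K` as a completely positive map. -/
def krausCP (K : ι → A) : A →CP A where
  toLinearMap := krausMap K
  map_cstarMatrix_nonneg' k M hM := by
    rw [map_krausMap_eq_krausMap_diagonal]
    exact (map_zero (krausMap _)).symm.trans_le (krausMap_monotone _ hM)

end KrausCP

section Choi

variable {H ι : Type*} [NormedAddCommGroup H] [InnerProductSpace ℂ H] [Fintype ι]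

theorem linearMap_ext_rankOne {M : Type*} [AddCommMonoid M] [Module ℂ M]
    (b : OrthonormalBasis ι ℂ H) {S T : (H →L[ℂ] H) →ₗ[ℂ] M}
    (h : ∀ i j, S (rankOne ℂ (b i) (b j)) = T (rankOne ℂ (b i) (b j))) : S = T := by
  ext X
  rw [op_eq_sum_rankOne b X]
  simp only [map_sum, map_smul, h]

variable [CompleteSpace H]

theorem rankOneMatrix_nonneg (b : OrthonormalBasis ι ℂ H) :
    (0 : CStarMatrix ι ι (H →L[ℂ] H)) ≤ CStarMatrix.ofMatrix fun i j => rankOne ℂ (b i) (b j) := by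
  set R : CStarMatrix ι ι (H →L[ℂ] H) := CStarMatrix.ofMatrix fun i j => rankOne ℂ (b i) (b j)
  have hentry i j k : star R i k * R k j = rankOne ℂ (b i) (b j) := by
    change (rankOne ℂ (b k) (b i)).adjoint ∘L rankOne ℂ (b k) (b j) = _
    rw [InnerProductSpace.adjoint_rankOne, InnerProductSpace.rankOne_comp_rankOne,
      b.inner_eq_one, one_smul]
  have hR : star R * R = (Fintype.card ι : ℂ) • R := by
    refine CStarMatrix.ext fun i j => ?_
    rw [CStarMatrix.mul_apply, CStarMatrix.smul_apply, Finset.sum_congr rfl fun k _ => hentry i j k,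
      Finset.sum_const, Finset.card_univ, Nat.cast_smul_eq_nsmul]
    rfl
  rcases isEmpty_or_nonempty ι with _ | _
  · exact le_of_eq (CStarMatrix.ext fun i => isEmptyElim i)
  · have hcard : (Fintype.card ι : ℂ) ≠ 0 := Nat.cast_ne_zero.2 Fintype.card_ne_zero
    rw [← inv_smul_smul₀ hcard R, ← hR]
    exact smul_nonneg (by positivity) (star_mul_self_nonneg R)

theorem exists_krausMap_eq [FiniteDimensional ℂ H] (E : (H →L[ℂ] H) →CP (H →L[ℂ] H)) :
    ∃ (n : ℕ) (K : Fin n × Fin n → H →L[ℂ] H), E.toLinearMap = krausMap K := by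
  let b := stdOrthonormalBasis ℂ H
  obtain ⟨B, hB⟩ := exists_eq_star_mul_self (E.map_cstarMatrix_nonneg _ (rankOneMatrix_nonneg b))
  have hE i j : E (rankOne ℂ (b i) (b j)) = ∑ k, star (B k i) * B k j :=
    congrArg (fun M => M i j) hB
  let K (p : Fin (Module.finrank ℂ H) × Fin (Module.finrank ℂ H)) : H →L[ℂ] H :=
    LinearMap.toContinuousLinearMap (b.toBasis.constr ℂ fun i => star (B p.1 i) (b p.2))
  have hK p i : K p (b i) = star (B p.1 i) (b p.2) := by
    rw [LinearMap.coe_toContinuousLinearMap', ← b.coe_toBasis, Module.Basis.constr_basis]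
  refine ⟨_, K, linearMap_ext_rankOne b fun i j => ?_⟩
  have hsandwich k m : K (k, m) * rankOne ℂ (b i) (b j) * star (K (k, m)) =
      star (B k i) * rankOne ℂ (b m) (b m) * B k j := by
    simp only [ContinuousLinearMap.mul_def, ContinuousLinearMap.star_eq_adjoint,
      InnerProductSpace.comp_rankOne, InnerProductSpace.rankOne_comp,
      ContinuousLinearMap.adjoint_adjoint, hK]
  calc E.toLinearMap (rankOne ℂ (b i) (b j)) = ∑ k, star (B k i) * B k j := hE i j
    _ = ∑ k, star (B k i) * (∑ m, rankOne ℂ (b m) (b m)) * B k j := by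
        simp only [b.sum_rankOne_eq_id, ← ContinuousLinearMap.one_def, mul_one]
    _ = krausMap K (rankOne ℂ (b i) (b j)) := by
        simp only [krausMap_apply, Fintype.sum_prod_type, hsandwich, Finset.mul_sum, Finset.sum_mul]

end Choi

section Trace

variable {H : Type*} [NormedAddCommGroup H] [InnerProductSpace ℂ H]

theorem tr_add (X Y : H →L[ℂ] H) : tr (X + Y) = tr X + tr Y := map_add (LinearMap.trace ℂ H) _ _

theorem tr_sub (X Y : H →L[ℂ] H) : tr (X - Y) = tr X - tr Y := map_sub (LinearMap.trace ℂ H) _ _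

theorem tr_mul_comm (X Y : H →L[ℂ] H) : tr (X * Y) = tr (Y * X) := tr_comp_comm X Y

variable [CompleteSpace H]

theorem tr_mul_nonneg {X Y : H →L[ℂ] H} (hX : 0 ≤ X) (hY : 0 ≤ Y) : 0 ≤ tr (X * Y) := by
  obtain ⟨a, rfl⟩ := CStarAlgebra.nonneg_iff_eq_star_mul_self.1 hX
  rw [mul_assoc, tr_mul_comm]
  exact ((ContinuousLinearMap.nonneg_iff_isPositive _).1
    (star_right_conjugate_nonneg hY a)).toLinearMap.trace_nonneg

variable [FiniteDimensional ℂ H]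

theorem eq_zero_of_tr_star_mul_self_eq_zero {X : H →L[ℂ] H} (h : tr (star X * X) = 0) : X = 0 := by
  let b := stdOrthonormalBasis ℂ H
  have hsum : ∑ i, ‖X (b i)‖ ^ 2 = 0 := by
    rw [tr, LinearMap.trace_eq_sum_inner _ b] at h
    simp only [ContinuousLinearMap.coe_coe, mul_apply_eq_comp, ContinuousLinearMap.star_eq_adjoint,
      ContinuousLinearMap.adjoint_inner_right, inner_self_eq_norm_sq_to_K,
      ← RCLike.ofReal_pow, ← RCLike.ofReal_sum, RCLike.ofReal_eq_zero] at h
    exact h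
  have hzero := (Finset.sum_eq_zero_iff_of_nonneg fun i _ => by positivity).1 hsum
  refine ContinuousLinearMap.coe_injective (b.toBasis.ext fun i => ?_)
  simpa using hzero i (Finset.mem_univ i)

theorem mul_eq_zero_of_tr_mul_eq_zero {X Y : H →L[ℂ] H} (hX : 0 ≤ X) (hY : 0 ≤ Y)
    (h : tr (X * Y) = 0) : X * Y = 0 := by
  obtain ⟨a, rfl⟩ := CStarAlgebra.nonneg_iff_eq_star_mul_self.1 hX
  obtain ⟨b, rfl⟩ := CStarAlgebra.nonneg_iff_eq_star_mul_self.1 hY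
  have hba : b * star a = 0 := by
    refine eq_zero_of_tr_star_mul_self_eq_zero ?_
    rw [tr_mul_comm] at h
    rw [star_mul, star_star, mul_assoc, tr_mul_comm]
    simpa only [mul_assoc] using h
  calc star a * a * (star b * b) = star a * star (b * star a) * b := by
        simp only [star_mul, star_star, mul_assoc]
    _ = 0 := by rw [hba, star_zero, mul_zero, zero_mul]

end Trace

section Positive

variable {H : Type*} [NormedAddCommGroup H] [InnerProductSpace ℂ H] [CompleteSpace H]

theorem ker_le_ker_of_le {X Y : H →L[ℂ] H} (hX : 0 ≤ X) (hXY : X ≤ Y) : Y.ker ≤ X.ker := by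
  intro x hx
  have hle : RCLike.re (inner ℂ x (X x)) ≤ 0 := by
    have := ((ContinuousLinearMap.le_def X Y).1 hXY).re_inner_nonneg_right x
    rwa [sub_apply, show Y x = 0 from hx, zero_sub, inner_neg_right, map_neg,
      Left.nonneg_neg_iff] at this
  obtain ⟨b, rfl⟩ := CStarAlgebra.nonneg_iff_eq_star_mul_self.1 hX
  rw [mul_apply_eq_comp, ContinuousLinearMap.star_eq_adjoint,
    ContinuousLinearMap.adjoint_inner_right, inner_self_eq_norm_sq,
    sq_nonpos_iff, norm_eq_zero] at hle
  change star b (b x) = 0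
  rw [hle, map_zero]

variable [FiniteDimensional ℂ H]

theorem range_le_range_of_le {X Y : H →L[ℂ] H} (hX : 0 ≤ X) (hXY : X ≤ Y) : X.range ≤ Y.range := by
  rw [← Submodule.orthogonal_orthogonal X.range, ← Submodule.orthogonal_orthogonal Y.range,
    X.orthogonal_range, Y.orthogonal_range, (IsSelfAdjoint.of_nonneg hX).adjoint_eq,
    (IsSelfAdjoint.of_nonneg (hX.trans hXY)).adjoint_eq]
  exact Submodule.orthogonal_le (ker_le_ker_of_le hX hXY)

theorem exists_isStarProjection_mul_eq_posPart {X : H →L[ℂ] H} (hX : IsSelfAdjoint X) :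
    ∃ P : H →L[ℂ] H, IsStarProjection P ∧ P * X = X⁺ := by
  refine ⟨(X⁺ : H →L[ℂ] H).range.starProjection, isStarProjection_starProjection, ?_⟩
  have hpos : (X⁺ : H →L[ℂ] H).range.starProjection * X⁺ = X⁺ := by
    ext x
    exact Submodule.starProjection_eq_self_iff.2 ⟨x, rfl⟩
  have hneg : (X⁺ : H →L[ℂ] H).range.starProjection * X⁻ = 0 := by
    ext x
    refine (Submodule.starProjection_apply_eq_zero_iff _).2 ?_
    rw [ContinuousLinearMap.orthogonal_range,
      (IsSelfAdjoint.of_nonneg (CFC.posPart_nonneg X)).adjoint_eq]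
    exact DFunLike.congr_fun (CFC.posPart_mul_negPart X) x
  calc _ = _ * (X⁺ - X⁻) := by rw [CFC.posPart_sub_negPart X hX]
    _ = X⁺ := by rw [mul_sub, hpos, hneg, sub_zero]

theorem eq_posPart_of_tr_eq {X Q : H →L[ℂ] H} (hX : IsSelfAdjoint X) (hQ : 0 ≤ Q) (hXQ : X ≤ Q)
    (h : tr Q = tr X⁺) : Q = X⁺ := by
  obtain ⟨P, hP, hPX⟩ := exists_isStarProjection_mul_eq_posPart hX
  have hR : 0 ≤ Q - X := sub_nonneg.2 hXQ
  have hsum : tr (P * (Q - X)) + tr ((1 - P) * Q) = 0 := by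
    rw [← tr_add, mul_sub, hPX, sub_mul, one_mul, sub_add_sub_cancel', tr_sub, h, sub_self]
  obtain ⟨htr₁, htr₂⟩ := (add_eq_zero_iff_of_nonneg (tr_mul_nonneg hP.nonneg hR)
    (tr_mul_nonneg hP.one_sub.nonneg hQ)).1 hsum
  have hPQX : P * (Q - X) = 0 := mul_eq_zero_of_tr_mul_eq_zero hP.nonneg hR htr₁
  have hPQ : (1 - P) * Q = 0 := mul_eq_zero_of_tr_mul_eq_zero hP.one_sub.nonneg hQ htr₂
  rw [sub_mul, one_mul, sub_eq_zero] at hPQ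
  rwa [mul_sub, hPX, ← hPQ, sub_eq_zero] at hPQX

end Positive

section TracePreserving

variable {H : Type*} [NormedAddCommGroup H] [InnerProductSpace ℂ H]

theorem mem_Fix {T : (H →L[ℂ] H) →ₗ[ℂ] (H →L[ℂ] H)} {X : H →L[ℂ] H} : X ∈ Fix T ↔ T X = X :=
  Iff.rfl

variable [CompleteSpace H] {T : (H →L[ℂ] H) →ₗ[ℂ] (H →L[ℂ] H)}

theorem map_star_of_monotone (hT : Monotone T) (X : H →L[ℂ] H) : T (star X) = star (T X) :=
  map_star (PositiveLinearMap.mk T hT) X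

theorem star_mem_Fix (hT : Monotone T) {X : H →L[ℂ] H} (hX : X ∈ Fix T) : star X ∈ Fix T := by
  rw [mem_Fix, map_star_of_monotone hT, mem_Fix.1 hX]

variable [FiniteDimensional ℂ H]

theorem posPart_mem_Fix (hT : Monotone T) (htr : IsTracePreserving T) {X : H →L[ℂ] H}
    (hX : IsSelfAdjoint X) (hfix : X ∈ Fix T) : X⁺ ∈ Fix T := by
  refine eq_posPart_of_tr_eq hX ?_ ?_ (htr _)
  · exact (map_zero T).symm.trans_le (hT (CFC.posPart_nonneg X))
  · exact (mem_Fix.1 hfix).symm.trans_le (hT (CFC.le_posPart hX))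

theorem mem_span_nonneg_Fix_of_isSelfAdjoint (hT : Monotone T) (htr : IsTracePreserving T)
    {X : H →L[ℂ] H} (hX : IsSelfAdjoint X) (hfix : X ∈ Fix T) :
    X ∈ Submodule.span ℂ {Y | 0 ≤ Y ∧ Y ∈ Fix T} := by
  have hneg : X⁻ ∈ Fix T := by
    rw [← CFC.posPart_neg]
    exact posPart_mem_Fix hT htr hX.neg (neg_mem hfix)
  rw [← CFC.posPart_sub_negPart X hX]
  exact sub_mem (Submodule.subset_span ⟨CFC.posPart_nonneg X, posPart_mem_Fix hT htr hX hfix⟩)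
    (Submodule.subset_span ⟨CFC.negPart_nonneg X, hneg⟩)

theorem Fix_le_span_nonneg (hT : Monotone T) (htr : IsTracePreserving T) :
    Fix T ≤ Submodule.span ℂ {Y | 0 ≤ Y ∧ Y ∈ Fix T} := by
  intro X hX
  have hre : (realPart X : H →L[ℂ] H) ∈ Fix T := by
    rw [realPart_apply_coe]
    exact Submodule.smul_of_tower_mem _ _ (add_mem hX (star_mem_Fix hT hX))
  have him : (imaginaryPart X : H →L[ℂ] H) ∈ Fix T := by
    rw [imaginaryPart_apply_coe]
    exact Submodule.smul_mem _ _
      (Submodule.smul_of_tower_mem _ _ (sub_mem hX (star_mem_Fix hT hX)))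
  rw [← realPart_add_I_smul_imaginaryPart X]
  exact add_mem (mem_span_nonneg_Fix_of_isSelfAdjoint hT htr (realPart X).2 hre)
    (Submodule.smul_mem _ _ (mem_span_nonneg_Fix_of_isSelfAdjoint hT htr (imaginaryPart X).2 him))

theorem exists_nonneg_forall_range_le (S : Submodule ℂ (H →L[ℂ] H)) :
    ∃ ρ ∈ S, 0 ≤ ρ ∧ ∀ X ∈ Submodule.span ℂ {Y | 0 ≤ Y ∧ Y ∈ S}, X.range ≤ ρ.range := by
  obtain ⟨ρ, ⟨hρ, hρS⟩, hmax⟩ := exists_maximalFor_of_wellFoundedGT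
    (fun Y : H →L[ℂ] H => 0 ≤ Y ∧ Y ∈ S) (fun Y => Y.range) ⟨0, le_rfl, zero_mem S⟩
  have hnonneg Y (hY : 0 ≤ Y ∧ Y ∈ S) : Y.range ≤ ρ.range :=
    (range_le_range_of_le hY.1 (le_add_of_nonneg_left hρ)).trans
      (hmax ⟨add_nonneg hρ hY.1, add_mem hρS hY.2⟩
        (range_le_range_of_le hρ (le_add_of_nonneg_right hY.1)))
  refine ⟨ρ, hρS, hρ, fun X hX => ?_⟩
  induction hX using Submodule.span_induction with
  | mem Y hY => exact hnonneg Y hY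
  | zero => rintro _ ⟨x, rfl⟩; exact zero_mem _
  | add X Y _ _ hX hY => rintro _ ⟨x, rfl⟩; exact add_mem (hX ⟨x, rfl⟩) (hY ⟨x, rfl⟩)
  | smul c X _ hX => rintro _ ⟨x, rfl⟩; exact Submodule.smul_mem _ _ (hX ⟨x, rfl⟩)

theorem exists_nonneg_mem_Fix_range_eq_support (hT : Monotone T) (htr : IsTracePreserving T) :
    ∃ ρ ∈ Fix T, 0 ≤ ρ ∧ ρ.range = support (Fix T : Set (H →L[ℂ] H)) := by
  obtain ⟨ρ, hfix, hρ, hmax⟩ := exists_nonneg_forall_range_le (Fix T)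
  have hrange X (hX : X ∈ Fix T) : X.range ≤ ρ.range := hmax X (Fix_le_span_nonneg hT htr hX)
  refine ⟨ρ, hfix, hρ, le_antisymm ?_ ?_⟩
  · exact le_sup_left.trans (le_iSup₂_of_le ρ hfix le_rfl)
  · exact iSup₂_le fun X hX => sup_le (hrange X hX) (hrange _ (star_mem_Fix hT hX))

end TracePreserving

section AdjointPair

variable {𝕜 V : Type*} [Field 𝕜] [AddCommGroup V] [Module 𝕜 V] [FiniteDimensional 𝕜 V]
  {B : LinearMap.BilinForm 𝕜 V} {S T : V →ₗ[𝕜] V}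

theorem range_eq_of_isAdjointPair (hB : B.Nondegenerate) (h : B.IsAdjointPair B S T) :
    S.range.map (B.toDual hB).toLinearMap = T.dualMap.range := by
  have hcomp : (B.toDual hB).toLinearMap ∘ₗ S = T.dualMap ∘ₗ (B.toDual hB).toLinearMap :=
    LinearMap.isAdjointPair_iff_comp_eq_compl₂.1 h
  rw [← LinearMap.range_comp, hcomp, LinearMap.range_comp_of_range_eq_top _
    (LinearEquiv.range _)]

theorem finrank_ker_eq_of_isAdjointPair (hB : B.Nondegenerate) (h : B.IsAdjointPair B S T) :
    Module.finrank 𝕜 S.ker = Module.finrank 𝕜 T.ker := by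
  have hrange : Module.finrank 𝕜 S.range = Module.finrank 𝕜 T.range := by
    rw [← LinearMap.finrank_range_dualMap_eq_finrank_range T, ← range_eq_of_isAdjointPair hB h]
    exact ((B.toDual hB).submoduleMap S.range).finrank_eq
  have hS := S.finrank_range_add_finrank_ker
  have hT := T.finrank_range_add_finrank_ker
  omega

theorem mem_range_of_isAdjointPair (hB : B.Nondegenerate) (h : B.IsAdjointPair B S T) {x : V}
    (hx : ∀ y ∈ T.ker, B x y = 0) : x ∈ S.range := by
  have hdual : B.toDual hB x ∈ S.range.map (B.toDual hB).toLinearMap := by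
    rw [range_eq_of_isAdjointPair hB h, LinearMap.range_dualMap_eq_dualAnnihilator_ker,
      Submodule.mem_dualAnnihilator]
    exact hx
  rwa [Submodule.mem_map_equiv, LinearEquiv.symm_apply_apply] at hdual

end AdjointPair

section Duality

variable {H : Type*} [NormedAddCommGroup H] [InnerProductSpace ℂ H]

/-- The bilinear form `(X, Y) ↦ tr (X Y)` on operators. It stands in for the sesquilinear
Hilbert-Schmidt inner product, for which Mathlib's adjoint pairs of bilinear forms are not
available. -/
def traceForm : LinearMap.BilinForm ℂ (H →L[ℂ] H) :=
  LinearMap.mk₂ ℂ (fun X Y => tr (X * Y)) (fun X Y Z => by rw [add_mul, tr_add])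
    (fun c X Y => by rw [smul_mul_assoc, tr_smul, smul_eq_mul])
    (fun X Y Z => by rw [mul_add, tr_add])
    (fun c X Y => by rw [mul_smul_comm, tr_smul, smul_eq_mul])

theorem Fix_eq_ker (T : (H →L[ℂ] H) →ₗ[ℂ] (H →L[ℂ] H)) : Fix T = (T - LinearMap.id).ker :=
  LinearMap.eqLocus_eq_ker_sub _ _

variable [FiniteDimensional ℂ H]

theorem eq_zero_of_forall_tr_mul_eq_zero [CompleteSpace H] {X : H →L[ℂ] H}
    (h : ∀ Y, tr (X * Y) = 0) : X = 0 :=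
  eq_zero_of_tr_star_mul_self_eq_zero (by rw [tr_mul_comm, h])

theorem traceForm_nondegenerate [CompleteSpace H] : (traceForm (H := H)).Nondegenerate :=
  ⟨fun _ hX => eq_zero_of_forall_tr_mul_eq_zero hX, fun _ hY =>
    eq_zero_of_forall_tr_mul_eq_zero fun X => (tr_mul_comm _ _).trans (hY X)⟩

end Duality

section DualChannel

variable {H ι : Type*} [NormedAddCommGroup H] [InnerProductSpace ℂ H] [CompleteSpace H] [Fintype ι]

theorem tr_mul_krausMap (K : ι → H →L[ℂ] H) (X Y : H →L[ℂ] H) :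
    tr (X * krausMap K Y) = tr (krausMap (star K) X * Y) := by
  simp only [krausMap_apply, Finset.mul_sum, Finset.sum_mul, tr_sum, Pi.star_apply, star_star]
  refine Finset.sum_congr rfl fun i _ => ?_
  rw [← mul_assoc, ← mul_assoc, tr_mul_comm]
  simp only [mul_assoc]

theorem isAdjointPair_traceForm_krausMap (K : ι → H →L[ℂ] H) :
    traceForm.IsAdjointPair traceForm (krausMap (star K) - LinearMap.id : _ →ₗ[ℂ] _)
      (krausMap K - LinearMap.id : _ →ₗ[ℂ] _) :=
  LinearMap.IsAdjointPair.sub (fun X Y => (tr_mul_krausMap K X Y).symm) LinearMap.isAdjointPair_id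

variable [FiniteDimensional ℂ H]

theorem hsAdjoint_krausMap (K : ι → H →L[ℂ] H) :
    hsAdjoint (krausMap K) = krausMap (star K) := by
  refine LinearMap.ext fun X => ?_
  rw [hsAdjoint_of_kraus (krausMap K) K fun _ => rfl, krausMap_apply]
  simp only [Pi.star_apply, star_star]
  rfl

theorem isTracePreserving_krausMap_iff {K : ι → H →L[ℂ] H} :
    IsTracePreserving (krausMap K) ↔ krausMap (star K) 1 = 1 := by
  have htr X : tr (krausMap K X) = tr (krausMap (star K) 1 * X) := by
    rw [← tr_mul_krausMap, one_mul]
  refine ⟨fun hK => sub_eq_zero.1 (eq_zero_of_forall_tr_mul_eq_zero fun X => ?_), fun hK X => ?_⟩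
  · rw [sub_mul, tr_sub, ← htr, hK, one_mul, sub_self]
  · rw [htr, hK, one_mul]

theorem finrank_Fix_krausMap_star (K : ι → H →L[ℂ] H) :
    Module.finrank ℂ (Fix (krausMap (star K))) = Module.finrank ℂ (Fix (krausMap K)) := by
  rw [Fix_eq_ker, Fix_eq_ker]
  exact finrank_ker_eq_of_isAdjointPair traceForm_nondegenerate (isAdjointPair_traceForm_krausMap K)

end DualChannel

section UnitalPositive

variable {A : Type*} [CStarAlgebra A] [PartialOrder A] [StarOrderedRing A]

theorem norm_pow_apply_le_of_nonneg {f : A →ₗ[ℂ] A} (hf : Monotone f) (hf1 : f 1 = 1) {a : A}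
    (ha : 0 ≤ a) (n : ℕ) : ‖(f ^ n) a‖ ≤ ‖(1 : A)‖ * ‖a‖ := by
  have hmono : Monotone (f ^ n) := by
    rw [Module.End.coe_pow]
    exact hf.iterate n
  have hone : (f ^ n) 1 = 1 := by
    rw [Module.End.coe_pow]
    exact Function.iterate_fixed hf1 n
  have := PositiveLinearMap.norm_apply_le_of_nonneg (PositiveLinearMap.mk (f ^ n) hmono) a ha
  rwa [show PositiveLinearMap.mk (f ^ n) hmono 1 = 1 from hone] at this

theorem exists_norm_pow_apply_le {f : A →ₗ[ℂ] A} (hf : Monotone f) (hf1 : f 1 = 1) (a : A) :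
    ∃ C : ℝ, ∀ n, ‖(f ^ n) a‖ ≤ C := by
  have ha : a ∈ Submodule.span ℂ {a : A | 0 ≤ a} :=
    CStarAlgebra.span_nonneg (A := A) ▸ Submodule.mem_top
  induction ha using Submodule.span_induction with
  | mem a ha => exact ⟨_, norm_pow_apply_le_of_nonneg hf hf1 ha⟩
  | zero => exact ⟨0, fun n => by rw [map_zero, norm_zero]⟩
  | add a b _ _ ha hb =>
    obtain ⟨C, hC⟩ := ha
    obtain ⟨D, hD⟩ := hb
    refine ⟨C + D, fun n => ?_⟩
    rw [map_add]
    exact norm_add_le_of_le (hC n) (hD n)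
  | smul c a _ ha =>
    obtain ⟨C, hC⟩ := ha
    refine ⟨‖c‖ * C, fun n => ?_⟩
    rw [map_smul, norm_smul]
    gcongr
    exact hC n

theorem eq_zero_of_apply_eq_add {f : A →ₗ[ℂ] A} (hf : Monotone f) (hf1 : f 1 = 1) {x z : A}
    (hx : f x = x) (hz : f z = z + x) : x = 0 := by
  obtain ⟨C, hC⟩ := exists_norm_pow_apply_le hf hf1 z
  have hpow (n : ℕ) : (f ^ n) z = z + n • x := by
    induction n with
    | zero => simp
    | succ n ih =>
      rw [pow_succ', Module.End.mul_apply, ih, map_add, map_nsmul, hx, hz, succ_nsmul', add_assoc]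
  have hbound (n : ℕ) : n • ‖x‖ ≤ C + ‖z‖ := by
    calc n • ‖x‖ = ‖(f ^ n) z - z‖ := by
          rw [hpow, add_sub_cancel_left, RCLike.norm_nsmul ℂ]
      _ ≤ C + ‖z‖ := norm_sub_le_of_le (hC n) le_rfl
  by_contra hne
  obtain ⟨n, hn⟩ := Archimedean.arch (C + ‖z‖ + 1) (norm_pos_iff.2 hne)
  linarith [hbound n]

end UnitalPositive

section UnitalKraus

variable {H ι : Type*} [NormedAddCommGroup H] [InnerProductSpace ℂ H] [CompleteSpace H]
  [FiniteDimensional ℂ H] [Fintype ι]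

theorem eq_zero_of_forall_mem_Fix_tr_mul_eq_zero {K : ι → H →L[ℂ] H}
    (hK : krausMap (star K) 1 = 1) {X : H →L[ℂ] H} (hX : X ∈ Fix (krausMap (star K)))
    (h : ∀ Y ∈ Fix (krausMap K), tr (X * Y) = 0) : X = 0 := by
  obtain ⟨Z, hZ⟩ := mem_range_of_isAdjointPair traceForm_nondegenerate
    (isAdjointPair_traceForm_krausMap K) (x := X) fun Y hY => h Y (sub_eq_zero.1 hY)
  exact eq_zero_of_apply_eq_add (krausMap_monotone _) hK (mem_Fix.1 hX) (sub_eq_iff_eq_add'.1 hZ)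

end UnitalKraus

section Faithful

variable {A ι : Type*} [Ring A] [StarRing A] [Algebra ℂ A]

theorem mem_centralizer_range_iff [StarModule ℂ A] {K : ι → A} {a : A} :
    a ∈ StarSubalgebra.centralizer ℂ (Set.range K) ↔
      ∀ i, K i * a = a * K i ∧ star (K i) * a = a * star (K i) := by
  rw [StarSubalgebra.mem_centralizer_iff, Set.forall_mem_range]

theorem mem_centralizer_range_star_iff [StarModule ℂ A] {K : ι → A} {a : A} :
    a ∈ StarSubalgebra.centralizer ℂ (Set.range (star K)) ↔
      a ∈ StarSubalgebra.centralizer ℂ (Set.range K) := by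
  simp only [mem_centralizer_range_iff, Pi.star_apply, star_star, and_comm]

variable [Fintype ι]

theorem krausMap_apply_star (K : ι → A) (X : A) : krausMap K (star X) = star (krausMap K X) := by
  simp only [krausMap_apply, star_sum, star_mul, star_star, mul_assoc]

theorem sum_star_lie_mul_lie {K : ι → A} (hK : krausMap (star K) 1 = 1) {X : A}
    (hX : krausMap (star K) X = X) :
    ∑ i, star ⁅K i, X⁆ * ⁅K i, X⁆ = krausMap (star K) (star X * X) - star X * X := by
  have hXs : krausMap (star K) (star X) = star X := by rw [krausMap_apply_star, hX]
  have hterm i : star ⁅K i, X⁆ * ⁅K i, X⁆ = star X * (star (K i) * K i) * X -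
      star X * (star (K i) * X * K i) - (star (K i) * star X * K i) * X +
      star (K i) * (star X * X) * K i := by
    rw [Ring.lie_def, star_sub, star_mul, star_mul]
    noncomm_ring
  simp only [krausMap_apply, Pi.star_apply, star_star, mul_one] at hK hX hXs ⊢
  simp only [hterm, Finset.sum_add_distrib, Finset.sum_sub_distrib, ← Finset.mul_sum,
    ← Finset.sum_mul, hK, hX, hXs, mul_one]
  abel

variable [StarModule ℂ A] {K : ι → A} {a : A}

theorem krausMap_mul_left (ha : a ∈ StarSubalgebra.centralizer ℂ (Set.range K)) (X : A) :
    krausMap K (a * X) = a * krausMap K X := by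
  rw [krausMap_apply, krausMap_apply, Finset.mul_sum]
  refine Finset.sum_congr rfl fun i _ => ?_
  rw [← mul_assoc, (mem_centralizer_range_iff.1 ha i).1]
  simp only [mul_assoc]

theorem krausMap_mul_right (ha : a ∈ StarSubalgebra.centralizer ℂ (Set.range K)) (X : A) :
    krausMap K (X * a) = krausMap K X * a := by
  rw [krausMap_apply, krausMap_apply, Finset.sum_mul]
  refine Finset.sum_congr rfl fun i _ => ?_
  rw [mul_assoc, mul_assoc, ← (mem_centralizer_range_iff.1 ha i).2]
  simp only [mul_assoc]

variable {H : Type*} [NormedAddCommGroup H] [InnerProductSpace ℂ H] [CompleteSpace H]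
  [FiniteDimensional ℂ H] {K : ι → H →L[ℂ] H} {ρ : H →L[ℂ] H}

theorem eq_zero_of_tr_star_mul_self_mul_eq_zero (hρ : IsStrictlyPositive ρ) {X : H →L[ℂ] H}
    (h : tr (star X * X * ρ) = 0) : X = 0 := by
  have := mul_eq_zero_of_tr_mul_eq_zero (star_mul_self_nonneg X) hρ.nonneg h
  rwa [hρ.isUnit.mul_left_eq_zero, CStarRing.star_mul_self_eq_zero_iff] at this

theorem lie_eq_zero_of_mem_Fix_krausMap_star (hK : krausMap (star K) 1 = 1)
    (hρ : IsStrictlyPositive ρ) (hfix : ρ ∈ Fix (krausMap K)) {X : H →L[ℂ] H}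
    (hX : X ∈ Fix (krausMap (star K))) (i : ι) : ⁅K i, X⁆ = 0 := by
  have hsum : ∑ i, tr (star ⁅K i, X⁆ * ⁅K i, X⁆ * ρ) = 0 := by
    rw [← tr_sum, ← Finset.sum_mul, sum_star_lie_mul_lie hK hX, sub_mul, tr_sub,
      ← tr_mul_krausMap, mem_Fix.1 hfix, sub_self]
  refine eq_zero_of_tr_star_mul_self_mul_eq_zero hρ ?_
  exact (Finset.sum_eq_zero_iff_of_nonneg fun i _ =>
    tr_mul_nonneg (star_mul_self_nonneg _) hρ.nonneg).1 hsum i (Finset.mem_univ i)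

theorem Fix_krausMap_star_eq_centralizer (hK : krausMap (star K) 1 = 1)
    (hρ : IsStrictlyPositive ρ) (hfix : ρ ∈ Fix (krausMap K)) :
    (Fix (krausMap (star K)) : Set (H →L[ℂ] H)) =
      StarSubalgebra.centralizer ℂ (Set.range K) := by
  ext X
  refine ⟨fun hX => mem_centralizer_range_iff.2 fun i => ?_, fun hX => ?_⟩
  · have hXs := star_mem_Fix (krausMap_monotone (star K)) hX
    have hcomm := lie_eq_zero_of_mem_Fix_krausMap_star hK hρ hfix hX i
    have hcomm_star := lie_eq_zero_of_mem_Fix_krausMap_star hK hρ hfix hXs i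
    rw [Ring.lie_def, sub_eq_zero] at hcomm hcomm_star
    have hstar := congrArg star hcomm_star
    rw [star_mul, star_mul, star_star] at hstar
    exact ⟨hcomm, hstar.symm⟩
  · have hmul := krausMap_mul_right (mem_centralizer_range_star_iff.2 hX) 1
    rwa [one_mul, hK, one_mul] at hmul

end Faithful

section Compression

variable {H : Type*} [NormedAddCommGroup H] [InnerProductSpace ℂ H] [FiniteDimensional ℂ H]
  (P : Submodule ℂ H)

theorem sandwich_eq_embed_compress (X : H →L[ℂ] H) : sandwich P X = embed P (compress P X) := rfl

theorem compress_embed (X : P →L[ℂ] P) : compress P (embed P X) = X := by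
  ext x
  simp [compress, embed]

theorem sandwich_embed (X : P →L[ℂ] P) : sandwich P (embed P X) = embed P X := by
  rw [sandwich_eq_embed_compress, compress_embed]

theorem embed_injective : Function.Injective (embed P) :=
  Function.LeftInverse.injective (compress_embed P)

theorem compress_one : compress P 1 = 1 := by
  ext x
  simp [compress]

theorem compress_nonneg {X : H →L[ℂ] H} (hX : 0 ≤ X) : 0 ≤ compress P X := by
  rw [ContinuousLinearMap.nonneg_iff_isPositive] at hX ⊢
  exact hX.orthogonalProjectionOnto_comp P

theorem tr_mul_sandwich (X Y : H →L[ℂ] H) :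
    tr (X * sandwich P Y) = tr (sandwich P X * Y) := by
  change tr (X * (P.starProjection * (Y * P.starProjection))) =
    tr (P.starProjection * (X * P.starProjection) * Y)
  rw [← mul_assoc, ← mul_assoc, tr_mul_comm]
  simp only [mul_assoc]

variable {P}

theorem compress_mul {X Y : H →L[ℂ] H} (hY : ∀ x ∈ P, Y x ∈ P) :
    compress P (X * Y) = compress P X * compress P Y := by
  ext x
  simp [compress, Submodule.starProjection_eq_self_iff.2 (hY x x.2)]

theorem mul_embed {Y : H →L[ℂ] H} (hY : ∀ x ∈ P, Y x ∈ P) (X : P →L[ℂ] P) :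
    Y * embed P X = embed P (compress P Y * X) := by
  ext x
  simp [compress, embed, Submodule.starProjection_eq_self_iff.2 (hY _ (Subtype.prop _))]

theorem compress_mem_Fix_restrict {T : (H →L[ℂ] H) →ₗ[ℂ] (H →L[ℂ] H)} {X : H →L[ℂ] H}
    (hX : X ∈ Fix T) (hP : sandwich P X = X) : compress P X ∈ Fix (restrict T P) := by
  change compress P (T (embed P (compress P X))) = compress P X
  rw [← sandwich_eq_embed_compress, hP, mem_Fix.1 hX]

theorem Fix_eq_map_embed {T : (H →L[ℂ] H) →ₗ[ℂ] (H →L[ℂ] H)} (hT : IsInvariantSubspace T P)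
    (hP : ∀ X ∈ Fix T, sandwich P X = X) : Fix T = (Fix (restrict T P)).map (embed P) := by
  ext X
  constructor
  · intro hX
    exact ⟨compress P X, compress_mem_Fix_restrict hX (hP X hX), hP X hX⟩
  · rintro ⟨x, hx, rfl⟩
    rw [mem_Fix, ← hT _ (sandwich_embed P x), sandwich_eq_embed_compress]
    exact congrArg (embed P) hx

variable [CompleteSpace H]

theorem star_compress (X : H →L[ℂ] H) : star (compress P X) = compress P (star X) := by
  simp [compress, ContinuousLinearMap.star_eq_adjoint, ContinuousLinearMap.adjoint_comp,
    Submodule.adjoint_subtypeL, Submodule.adjoint_orthogonalProjectionOnto,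
    ContinuousLinearMap.comp_assoc]

theorem star_embed (X : P →L[ℂ] P) : star (embed P X) = embed P (star X) := by
  simp [embed, ContinuousLinearMap.star_eq_adjoint, ContinuousLinearMap.adjoint_comp,
    Submodule.adjoint_subtypeL, Submodule.adjoint_orthogonalProjectionOnto,
    ContinuousLinearMap.comp_assoc]

theorem compress_star_mul {X Y : H →L[ℂ] H} (hX : ∀ x ∈ P, X x ∈ P) :
    compress P (star X * Y) = star (compress P X) * compress P Y := by
  have h := congrArg star (compress_mul (X := star Y) hX)
  rwa [star_compress, star_mul, star_star, star_mul (compress P _), star_compress (star Y),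
    star_star] at h

theorem embed_mul_star {Y : H →L[ℂ] H} (hY : ∀ x ∈ P, Y x ∈ P) (X : P →L[ℂ] P) :
    embed P X * star Y = embed P (X * star (compress P Y)) := by
  have h := congrArg star (mul_embed hY (star X))
  rwa [star_mul, star_embed, star_star X, star_embed, star_mul (compress P Y), star_star X] at h

theorem sandwich_eq_self_of_range_le {X : H →L[ℂ] H} (hX : X.range ≤ P)
    (hX_adjoint : X.adjoint.range ≤ P) : sandwich P X = X := by
  have hleft {Y : H →L[ℂ] H} (hY : Y.range ≤ P) : P.starProjection * Y = Y := by
    ext x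
    exact Submodule.starProjection_eq_self_iff.2 (hY ⟨x, rfl⟩)
  have hright : X * P.starProjection = X := by
    have := congrArg star (hleft hX_adjoint)
    rwa [← ContinuousLinearMap.star_eq_adjoint, star_mul, star_star,
      isStarProjection_starProjection.isSelfAdjoint.star_eq] at this
  calc sandwich P X = P.starProjection * (X * P.starProjection) := rfl
    _ = X := by rw [hright, hleft hX]

theorem sandwich_support_eq_self {S : Set (H →L[ℂ] H)} {X : H →L[ℂ] H} (hX : X ∈ S) :
    sandwich (support S) X = X :=
  sandwich_eq_self_of_range_le (le_sup_left.trans (le_iSup₂_of_le X hX le_rfl))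
    (le_sup_right.trans (le_iSup₂_of_le X hX le_rfl))

theorem isStrictlyPositive_compress_range {ρ : H →L[ℂ] H} (hρ : 0 ≤ ρ) :
    IsStrictlyPositive (compress ρ.range ρ) := by
  refine IsStrictlyPositive.iff_of_unital.2 ⟨compress_nonneg _ hρ, ?_⟩
  rw [ContinuousLinearMap.isUnit_iff_isUnit_toLinearMap, LinearMap.isUnit_iff_ker_eq_bot,
    LinearMap.ker_eq_bot']
  intro x hx
  have hx_ker : ρ x = 0 := by
    simpa [compress, Submodule.starProjection_eq_self_iff.2 (show ρ x ∈ ρ.range from ⟨x, rfl⟩)]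
      using congrArg Subtype.val hx
  have hx_orthogonal : (x : H) ∈ ρ.rangeᗮ := by
    have hself : ρ.adjoint = ρ := (IsSelfAdjoint.of_nonneg hρ).star_eq
    rw [ContinuousLinearMap.orthogonal_range, hself]
    exact hx_ker
  exact Subtype.ext (Submodule.disjoint_def.1 ρ.range.orthogonal_disjoint x x.2 hx_orthogonal)

end Compression

section InvariantSubspace

variable {H ι : Type*} [NormedAddCommGroup H] [InnerProductSpace ℂ H] [FiniteDimensional ℂ H]
  [CompleteSpace H] [Fintype ι] {P : Submodule ℂ H} {K : ι → H →L[ℂ] H}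

theorem krausMap_embed (hK : ∀ i, ∀ x ∈ P, K i x ∈ P) (X : P →L[ℂ] P) :
    krausMap K (embed P X) = embed P (krausMap (fun i => compress P (K i)) X) := by
  rw [krausMap_apply, krausMap_apply, map_sum]
  exact Finset.sum_congr rfl fun i _ => by rw [mul_embed (hK i), embed_mul_star (hK i)]

theorem isInvariantSubspace_krausMap (hK : ∀ i, ∀ x ∈ P, K i x ∈ P) :
    IsInvariantSubspace (krausMap K) P := fun X hX => by
  have hembed : krausMap K X = embed P (krausMap (fun i => compress P (K i)) (compress P X)) := by
    rw [← krausMap_embed hK, ← sandwich_eq_embed_compress, hX]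
  rw [hembed, sandwich_embed]

theorem restrict_krausMap (K : ι → H →L[ℂ] H) :
    restrict (krausMap K) P = krausMap fun i => compress P (K i) := by
  refine LinearMap.ext fun X => ?_
  change compress P (krausMap K (embed P X)) = _
  rw [krausMap_apply, map_sum, krausMap_apply]
  refine Finset.sum_congr rfl fun i _ => ?_
  rw [star_compress]
  ext x
  simp [compress, embed]

theorem krausMap_star_compress (hK : ∀ i, ∀ x ∈ P, K i x ∈ P) (X : H →L[ℂ] H) :
    krausMap (star fun i => compress P (K i)) (compress P X) =
      compress P (krausMap (star K) X) := by
  simp only [krausMap_apply, map_sum, Pi.star_apply, star_star]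
  refine Finset.sum_congr rfl fun i _ => ?_
  rw [compress_mul (hK i), compress_star_mul (hK i), star_star (compress P (K i))]

theorem range_mul_star_self (X : H →L[ℂ] H) : (X * star X).range = X.range := by
  have := LinearMap.range_self_comp_adjoint (X : H →ₗ[ℂ] H)
  rwa [LinearMap.adjoint_eq_toCLM_adjoint] at this

theorem apply_mem_range_of_mem_Fix_krausMap {ρ : H →L[ℂ] H} (hρ : 0 ≤ ρ)
    (hfix : ρ ∈ Fix (krausMap K)) (i : ι) {x : H} (hx : x ∈ ρ.range) : K i x ∈ ρ.range := by
  have hle : K i * ρ * star (K i) ≤ ρ := by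
    conv_rhs => rw [← mem_Fix.1 hfix, krausMap_apply]
    exact Finset.single_le_sum (f := fun i => K i * ρ * star (K i))
      (fun j _ => star_right_conjugate_nonneg hρ (K j)) (Finset.mem_univ i)
  obtain ⟨b, hb⟩ := CStarAlgebra.nonneg_iff_eq_star_mul_self.1 hρ
  have hrange : ρ.range = (star b).range := by
    rw [← range_mul_star_self (star b), star_star, hb]
  have hmap : (K i * star b).range ≤ ρ.range := by
    rw [← range_mul_star_self, star_mul, star_star]
    refine le_trans (le_of_eq ?_) (range_le_range_of_le (star_right_conjugate_nonneg hρ _) hle)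
    rw [hb]
    simp only [mul_assoc]
  obtain ⟨y, rfl⟩ := hrange ▸ hx
  exact hmap ⟨y, rfl⟩

theorem injOn_compress_Fix_krausMap_star (hK1 : krausMap (star K) 1 = 1)
    (hP : ∀ X ∈ Fix (krausMap K), sandwich P X = X) :
    Set.InjOn (compress P) (Fix (krausMap (star K))) := by
  intro X hX Y hY h
  have hsandwich : sandwich P (X - Y) = 0 := by
    rw [sandwich_eq_embed_compress, map_sub, h, sub_self, map_zero]
  refine sub_eq_zero.1 (eq_zero_of_forall_mem_Fix_tr_mul_eq_zero hK1 (sub_mem hX hY) fun Z hZ => ?_)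
  rw [← hP Z hZ, tr_mul_sandwich, hsandwich, zero_mul]
  exact map_zero (LinearMap.trace ℂ H)

theorem map_compress_Fix_krausMap_star (hK1 : krausMap (star K) 1 = 1)
    (hK : ∀ i, ∀ x ∈ P, K i x ∈ P) (hP : ∀ X ∈ Fix (krausMap K), sandwich P X = X) :
    (Fix (krausMap (star K))).map (compress P) =
      Fix (krausMap (star fun i => compress P (K i))) := by
  refine Submodule.eq_of_le_of_finrank_eq ?_ ?_
  · rintro _ ⟨X, hX, rfl⟩
    rw [mem_Fix, krausMap_star_compress hK, mem_Fix.1 hX]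
  have hinj : Function.Injective ((compress P).domRestrict (Fix (krausMap (star K)))) :=
    (injOn_compress_Fix_krausMap_star hK1 hP).injective
  have hFix : Fix (krausMap K) = (Fix (krausMap fun i => compress P (K i))).map (embed P) := by
    rw [Fix_eq_map_embed (isInvariantSubspace_krausMap hK) hP, restrict_krausMap]
  rw [← LinearMap.range_domRestrict, LinearMap.finrank_range_of_inj hinj, finrank_Fix_krausMap_star,
    finrank_Fix_krausMap_star, hFix]
  exact (Submodule.equivMapOfInjective _ (embed_injective P) _).finrank_eq.symm

end InvariantSubspace

namespace SectorDecomposition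

variable {K : Type*} [NormedAddCommGroup K] [InnerProductSpace ℂ K] (σ : SectorDecomposition K)

/-- The orthonormal basis adapted to a sector decomposition. -/
def basis : OrthonormalBasis (Σ k, Fin (σ.d k) × Fin (σ.n k)) ℂ K :=
  OrthonormalBasis.ofRepr σ.U

theorem inner_op (M : ∀ k, Matrix (Fin (σ.d k)) (Fin (σ.d k)) ℂ)
    (N : ∀ k, Matrix (Fin (σ.n k)) (Fin (σ.n k)) ℂ)
    (x y : Σ k, Fin (σ.d k) × Fin (σ.n k)) :
    inner ℂ (σ.basis x) (σ.op M N (σ.basis y)) =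
      Matrix.blockDiagonal' (fun k => M k ⊗ₖ N k) x y := by
  have hy : σ.U (σ.basis y) = EuclideanSpace.single y 1 := σ.basis.repr_self y
  rw [← σ.basis.repr_apply_apply]
  change σ.U (σ.U.symm (Matrix.toEuclideanCLM (𝕜 := ℂ)
    (Matrix.blockDiagonal' fun k => M k ⊗ₖ N k) (σ.U (σ.basis y)))) x = _
  rw [σ.U.apply_symm_apply, hy, Matrix.ofLp_toEuclideanCLM, PiLp.ofLp_single,
    Matrix.mulVec_single_one, Matrix.col_apply]

theorem op_eq_sum_smul_rankOne (M : ∀ k, Matrix (Fin (σ.d k)) (Fin (σ.d k)) ℂ)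
    (N : ∀ k, Matrix (Fin (σ.n k)) (Fin (σ.n k)) ℂ) :
    σ.op M N = ∑ k, ∑ a, ∑ b, ∑ a', ∑ b',
      (M k a a' * N k b b') • rankOne ℂ (σ.basis ⟨k, a, b⟩) (σ.basis ⟨k, a', b'⟩) := by
  rw [op_eq_sum_rankOne σ.basis (σ.op M N)]
  simp only [inner_op, Fintype.sum_sigma, Fintype.sum_prod_type]
  refine Finset.sum_congr rfl fun k _ => Finset.sum_congr rfl fun a _ =>
    Finset.sum_congr rfl fun b _ => ?_
  rw [Finset.sum_eq_single_of_mem k (Finset.mem_univ k) fun l _ hl => ?_]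
  · simp only [Matrix.blockDiagonal'_apply_eq, Matrix.kroneckerMap_apply]
  · simp only [Matrix.blockDiagonal'_apply_ne _ _ _ hl.symm, zero_smul, Finset.sum_const_zero]

theorem op_one_right_eq_sum (M : ∀ k, Matrix (Fin (σ.d k)) (Fin (σ.d k)) ℂ) :
    σ.op M 1 = ∑ k, ∑ a, ∑ a',
      M k a a' • ∑ b, rankOne ℂ (σ.basis ⟨k, a, b⟩) (σ.basis ⟨k, a', b⟩) := by
  rw [op_eq_sum_smul_rankOne]
  refine Finset.sum_congr rfl fun k _ => Finset.sum_congr rfl fun a _ => ?_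
  rw [Finset.sum_comm]
  simp [Matrix.one_apply, Finset.smul_sum]

theorem op_one_left_eq_sum (N : ∀ k, Matrix (Fin (σ.n k)) (Fin (σ.n k)) ℂ) :
    σ.op 1 N = ∑ k, ∑ a, ∑ b, ∑ b',
      N k b b' • rankOne ℂ (σ.basis ⟨k, a, b⟩) (σ.basis ⟨k, a, b'⟩) := by
  rw [op_eq_sum_smul_rankOne]
  refine Finset.sum_congr rfl fun k _ => Finset.sum_congr rfl fun a _ =>
    Finset.sum_congr rfl fun b _ => ?_
  simp [Matrix.one_apply, ite_smul, Finset.sum_ite_irrel]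

theorem op_single_single_one (k : Fin σ.sectors) (a a' : Fin (σ.d k)) :
    σ.op (Pi.single k (Matrix.single a a' 1)) 1 =
      ∑ b, rankOne ℂ (σ.basis ⟨k, a, b⟩) (σ.basis ⟨k, a', b⟩) := by
  rw [op_one_right_eq_sum, Finset.sum_eq_single_of_mem k (Finset.mem_univ k) fun l _ hl => ?_]
  · simp [Matrix.single_apply, ite_and]
  · simp [Pi.single_eq_of_ne hl]

/-- The block of `ρ` at the basis vector `a₀ k` of each factor `Aₖ`: the matrix of
`(⟨a₀ k| ⊗ 1) ρ (|a₀ k⟩ ⊗ 1)` on `Bₖ`. -/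
def corner (ρ : K →L[ℂ] K) (a₀ : ∀ k, Fin (σ.d k)) (k : Fin σ.sectors) :
    Matrix (Fin (σ.n k)) (Fin (σ.n k)) ℂ :=
  Matrix.of fun b b' => inner ℂ (σ.basis ⟨k, a₀ k, b⟩) (ρ (σ.basis ⟨k, a₀ k, b'⟩))

theorem op_one_corner (ρ : K →L[ℂ] K) (a₀ : ∀ k, Fin (σ.d k)) :
    σ.op 1 (σ.corner ρ a₀) = ∑ k, ∑ a, σ.op (Pi.single k (Matrix.single a (a₀ k) 1)) 1 * ρ *
      σ.op (Pi.single k (Matrix.single (a₀ k) a 1)) 1 := by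
  rw [op_one_left_eq_sum]
  refine Finset.sum_congr rfl fun k _ => Finset.sum_congr rfl fun a _ => ?_
  rw [op_single_single_one, op_single_single_one, Finset.sum_mul, Finset.sum_mul_sum]
  refine Finset.sum_congr rfl fun b _ => Finset.sum_congr rfl fun b' _ => ?_
  ext x
  simp [corner, smul_smul, mul_comm]

variable [CompleteSpace K]

/-- The `*`-isomorphism between the operators on `K` and the matrices over the adapted basis. -/
def matrixEquiv : Matrix (Σ k, Fin (σ.d k) × Fin (σ.n k)) (Σ k, Fin (σ.d k) × Fin (σ.n k)) ℂ ≃⋆ₐ[ℂ]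
    (K →L[ℂ] K) :=
  Matrix.toEuclideanCLM.trans σ.U.symm.conjStarAlgEquiv

theorem op_eq_matrixEquiv (M : ∀ k, Matrix (Fin (σ.d k)) (Fin (σ.d k)) ℂ)
    (N : ∀ k, Matrix (Fin (σ.n k)) (Fin (σ.n k)) ℂ) :
    σ.op M N = σ.matrixEquiv (Matrix.blockDiagonal' fun k => M k ⊗ₖ N k) := rfl

/-- The bilinear map `(M, N) ↦ ⨁ₖ M k ⊗ N k`. -/
def opBilin : (∀ k, Matrix (Fin (σ.d k)) (Fin (σ.d k)) ℂ) →ₗ[ℂ]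
    (∀ k, Matrix (Fin (σ.n k)) (Fin (σ.n k)) ℂ) →ₗ[ℂ] K →L[ℂ] K :=
  LinearMap.mk₂ ℂ σ.op
    (fun _ _ _ => by
      simp only [op_eq_matrixEquiv, ← map_add, ← Matrix.blockDiagonal'_add, Pi.add_apply,
        Matrix.add_kronecker]
      rfl)
    (fun _ _ _ => by
      simp only [op_eq_matrixEquiv, ← map_smul, ← Matrix.blockDiagonal'_smul, Pi.smul_apply,
        Matrix.smul_kronecker]
      rfl)
    (fun _ _ _ => by
      simp only [op_eq_matrixEquiv, ← map_add, ← Matrix.blockDiagonal'_add, Pi.add_apply,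
        Matrix.kronecker_add]
      rfl)
    (fun _ _ _ => by
      simp only [op_eq_matrixEquiv, ← map_smul, ← Matrix.blockDiagonal'_smul, Pi.smul_apply,
        Matrix.kronecker_smul]
      rfl)

theorem op_mul_op (M M' : ∀ k, Matrix (Fin (σ.d k)) (Fin (σ.d k)) ℂ)
    (N N' : ∀ k, Matrix (Fin (σ.n k)) (Fin (σ.n k)) ℂ) :
    σ.op M N * σ.op M' N' = σ.op (M * M') (N * N') := by
  simp only [op_eq_matrixEquiv, ← map_mul, ← Matrix.blockDiagonal'_mul, Matrix.mul_kronecker_mul,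
    Pi.mul_apply]

theorem op_one_one : σ.op 1 1 = 1 := by
  simp only [op_eq_matrixEquiv, Pi.one_apply, Matrix.one_kronecker_one]
  exact (congrArg σ.matrixEquiv Matrix.blockDiagonal'_one).trans (map_one _)

theorem star_op (M : ∀ k, Matrix (Fin (σ.d k)) (Fin (σ.d k)) ℂ)
    (N : ∀ k, Matrix (Fin (σ.n k)) (Fin (σ.n k)) ℂ) : star (σ.op M N) = σ.op (star M) (star N) := by
  simp only [op_eq_matrixEquiv, ← map_star, Matrix.star_eq_conjTranspose,
    Matrix.blockDiagonal'_conjTranspose, Matrix.conjTranspose_kronecker, Pi.star_apply]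

theorem op_eq_op_one_mul_op_one (M : ∀ k, Matrix (Fin (σ.d k)) (Fin (σ.d k)) ℂ)
    (N : ∀ k, Matrix (Fin (σ.n k)) (Fin (σ.n k)) ℂ) : σ.op M N = σ.op M 1 * σ.op 1 N := by
  rw [op_mul_op, mul_one, one_mul]

theorem coe_range_opBilin_flip (N : ∀ k, Matrix (Fin (σ.n k)) (Fin (σ.n k)) ℂ) :
    ((σ.opBilin.flip N).range : Set (K →L[ℂ] K)) = σ.blockSet N := rfl

theorem opBilin_flip_injective {N : ∀ k, Matrix (Fin (σ.n k)) (Fin (σ.n k)) ℂ}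
    (hN : ∀ k, N k ≠ 0) : Function.Injective (σ.opBilin.flip N) := by
  intro M M' h
  funext k
  obtain ⟨b, b', hb⟩ : ∃ b b', N k b b' ≠ 0 := by
    by_contra! h0
    exact hN k (Matrix.ext h0)
  ext a a'
  have hblock := congrFun (Matrix.blockDiagonal'_injective (σ.matrixEquiv.injective h)) k
  exact mul_right_cancel₀ hb (congrFun (congrFun hblock (a, b)) (a', b'))

end SectorDecomposition

section Reducing

variable {K : Type*} [NormedAddCommGroup K] [InnerProductSpace ℂ K] [CompleteSpace K]

/-- `V` is invariant under all members of `s` and their adjoints. -/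
def IsReducing (s : Set (K →L[ℂ] K)) (V : Submodule ℂ K) : Prop :=
  ∀ g ∈ s ∪ star s, ∀ x ∈ V, g x ∈ V

/-- `V` is minimal among the nonzero subspaces that reduce `s`. -/
def IsMinimalReducing (s : Set (K →L[ℂ] K)) (V : Submodule ℂ K) : Prop :=
  Minimal (fun W => IsReducing s W ∧ W ≠ ⊥) V

/-- Two subspaces are equivalent if a partial isometry of the commutant of `s` maps one onto the
other. -/
def CommutantEquiv (s : Set (K →L[ℂ] K)) (V W : Submodule ℂ K) [V.HasOrthogonalProjection]
    [W.HasOrthogonalProjection] : Prop :=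
  ∃ u ∈ StarSubalgebra.centralizer ℂ s,
    star u * u = V.starProjection ∧ u * star u = W.starProjection

variable {s : Set (K →L[ℂ] K)} {V W X : Submodule ℂ K}

theorem mul_eq_self_of_star_mul_self_eq {A : Type*} [NonUnitalNormedRing A] [StarRing A]
    [CStarRing A] {u p : A} (hp : IsStarProjection p) (h : star u * u = p) : u * p = u := by
  rw [← sub_eq_zero, ← CStarRing.star_mul_self_eq_zero_iff, star_sub, star_mul,
    hp.isSelfAdjoint.star_eq]
  calc (p * star u - star u) * (u * p - u)
      = p * (star u * u) * p - p * (star u * u) - star u * u * p + star u * u := by noncomm_ring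
    _ = 0 := by simp [h, hp.isIdempotentElem.eq]

theorem mul_star_eq_star_of_star_mul_self_eq {A : Type*} [NonUnitalNormedRing A] [StarRing A]
    [CStarRing A] {u p : A} (hp : IsStarProjection p) (h : star u * u = p) :
    p * star u = star u := by
  have h' := congrArg star (mul_eq_self_of_star_mul_self_eq hp h)
  rwa [star_mul, hp.isSelfAdjoint.star_eq] at h'

theorem IsReducing.orthogonal (hV : IsReducing s V) : IsReducing s Vᗮ := by
  intro g hg x hx y hy
  have hg' : star g ∈ s ∪ star s :=
    hg.elim (fun h => Or.inr (Set.star_mem_star.2 h)) fun h => Or.inl h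
  rw [← ContinuousLinearMap.adjoint_inner_left]
  exact hx _ (hV _ hg' y hy)

theorem IsReducing.inf (hV : IsReducing s V) (hW : IsReducing s W) : IsReducing s (V ⊓ W) :=
  fun g hg x hx => ⟨hV g hg x hx.1, hW g hg x hx.2⟩

theorem isReducing_sSup {c : Set (Submodule ℂ K)} (hc : ∀ V ∈ c, IsReducing s V) :
    IsReducing s (sSup c) := by
  intro g hg
  suffices h : sSup c ≤ (sSup c).comap (g : K →ₗ[ℂ] K) from fun x hx => h hx
  exact sSup_le fun V hV x hx => le_sSup hV (hc V hV g hg x hx)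

theorem isReducing_ker {a : K →L[ℂ] K} (ha : a ∈ StarSubalgebra.centralizer ℂ s) :
    IsReducing s a.ker := by
  intro g hg x hx
  have hga : g (a x) = a (g x) := DFunLike.congr_fun (ha g hg) x
  rw [LinearMap.mem_ker] at hx ⊢
  exact hga.symm.trans ((congrArg g hx).trans (map_zero g))

theorem IsReducing.starProjection_mem [V.HasOrthogonalProjection] (hV : IsReducing s V) :
    V.starProjection ∈ StarSubalgebra.centralizer ℂ s := by
  refine fun g hg => ContinuousLinearMap.ext fun x => ?_
  have hfix := Submodule.starProjection_eq_self_iff.2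
    (hV g hg _ (Submodule.starProjection_apply_mem V x))
  have hzero := (Submodule.starProjection_apply_eq_zero_iff _).2
    (hV.orthogonal g hg _ (V.sub_starProjection_mem_orthogonal x))
  rw [map_sub, map_sub, hfix, sub_eq_zero] at hzero
  exact hzero.symm

theorem CommutantEquiv.refl [V.HasOrthogonalProjection] (hV : IsReducing s V) :
    CommutantEquiv s V V := by
  have hp : IsStarProjection V.starProjection := isStarProjection_starProjection
  exact ⟨_, hV.starProjection_mem, by rw [hp.isSelfAdjoint.star_eq, hp.isIdempotentElem.eq],
    by rw [hp.isSelfAdjoint.star_eq, hp.isIdempotentElem.eq]⟩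

theorem CommutantEquiv.symm [V.HasOrthogonalProjection] [W.HasOrthogonalProjection]
    (h : CommutantEquiv s V W) : CommutantEquiv s W V := by
  obtain ⟨u, hu, hV, hW⟩ := h
  exact ⟨star u, star_mem hu, by rwa [star_star], by rwa [star_star]⟩

theorem CommutantEquiv.trans [V.HasOrthogonalProjection] [W.HasOrthogonalProjection]
    [X.HasOrthogonalProjection] (hVW : CommutantEquiv s V W) (hWX : CommutantEquiv s W X) :
    CommutantEquiv s V X := by
  obtain ⟨u, hu, huV, huW⟩ := hVW
  obtain ⟨v, hv, hvW, hvX⟩ := hWX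
  have hWu : W.starProjection * u = u := by
    rw [← huW, mul_assoc, huV,
      mul_eq_self_of_star_mul_self_eq isStarProjection_starProjection huV]
  have hWv : W.starProjection * star v = star v :=
    mul_star_eq_star_of_star_mul_self_eq isStarProjection_starProjection hvW
  refine ⟨v * u, mul_mem hv hu, ?_, ?_⟩
  · rw [star_mul, mul_assoc, ← mul_assoc (star v), hvW, hWu, huV]
  · rw [star_mul, mul_assoc, ← mul_assoc u, huW, hWv, hvX]

theorem exists_pos_of_star_mul_self_eq_smul {A : Type*} [CStarAlgebra A] [PartialOrder A]
    [StarOrderedRing A] {b p : A} {t : ℂ} (hp : IsStarProjection p) (h : star b * b = t • p)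
    (hb : b ≠ 0) : ∃ r : ℝ, 0 < r ∧ t = r := by
  have hne : t • p ≠ 0 := by rwa [← h, Ne, CStarRing.star_mul_self_eq_zero_iff]
  have hconj : star t • p = t • p := by
    rw [← h, ← (IsSelfAdjoint.star_mul_self b).star_eq, h, star_smul, hp.isSelfAdjoint.star_eq]
  obtain ⟨r, rfl⟩ := Complex.conj_eq_iff_real.1
    (smul_left_injective ℂ (right_ne_zero_of_smul hne) hconj)
  refine ⟨r, ?_, rfl⟩
  by_contra! hr
  refine hne (le_antisymm ?_ (h ▸ star_mul_self_nonneg b))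
  rw [Complex.coe_smul]
  exact smul_nonpos_of_nonpos_of_nonneg hr hp.nonneg

theorem exists_smul_star_mul_self_eq {A : Type*} [CStarAlgebra A] [PartialOrder A]
    [StarOrderedRing A] {b p q : A} {t t' : ℂ} (hp : IsStarProjection p)
    (hbp : b * p = b) (hqb : q * b = b) (h : star b * b = t • p) (h' : b * star b = t' • q)
    (hb : b ≠ 0) : ∃ c : ℂ, star (c • b) * (c • b) = p ∧ (c • b) * star (c • b) = q := by
  obtain rfl : t = t' := by
    refine smul_left_injective ℂ hb ?_
    calc t • b = b * (star b * b) := by rw [h, mul_smul_comm, hbp]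
      _ = t' • b := by rw [← mul_assoc, h', smul_mul_assoc, hqb]
  obtain ⟨r, hr, rfl⟩ := exists_pos_of_star_mul_self_eq_smul hp h hb
  have hc : (((Real.sqrt r)⁻¹ : ℝ) : ℂ) * (((Real.sqrt r)⁻¹ : ℝ) : ℂ) * (r : ℂ) = 1 := by
    rw [← Complex.ofReal_mul, ← Complex.ofReal_mul, ← mul_inv, Real.mul_self_sqrt hr.le,
      inv_mul_cancel₀ hr.ne', Complex.ofReal_one]
  refine ⟨((Real.sqrt r)⁻¹ : ℝ), ?_, ?_⟩
  · rw [star_smul, Complex.star_def, Complex.conj_ofReal, smul_mul_smul_comm, h, smul_smul, hc,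
      one_smul]
  · rw [star_smul, Complex.star_def, Complex.conj_ofReal, smul_mul_smul_comm, h', smul_smul, hc,
      one_smul]

variable [FiniteDimensional ℂ K]

theorem exists_isMinimalReducing_le (hW : IsReducing s W) (h0 : W ≠ ⊥) :
    ∃ V ≤ W, IsMinimalReducing s V :=
  exists_minimal_le_of_wellFoundedLT (fun W => IsReducing s W ∧ W ≠ ⊥) W ⟨hW, h0⟩

theorem IsMinimalReducing.exists_forall_mem_apply_eq_smul (hV : IsMinimalReducing s V)
    {a : K →L[ℂ] K} (ha : a ∈ StarSubalgebra.centralizer ℂ s) (hmap : ∀ x ∈ V, a x ∈ V) :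
    ∃ c : ℂ, ∀ x ∈ V, a x = c • x := by
  have : Nontrivial V := Submodule.nontrivial_iff_ne_bot.2 hV.prop.2
  obtain ⟨c, hc⟩ := Module.End.exists_eigenvalue ((a : K →ₗ[ℂ] K).restrict hmap)
  obtain ⟨v, hv⟩ := hc.exists_hasEigenvector
  have hav : a v = c • (v : K) := congrArg Subtype.val hv.apply_eq_smul
  have hmem (x : K) : x ∈ (a - algebraMap ℂ (K →L[ℂ] K) c).ker ↔ a x = c • x := by
    simp [Algebra.algebraMap_eq_smul_one, sub_eq_zero]
  have hker := isReducing_ker (sub_mem ha (StarSubalgebra.algebraMap_mem _ c))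
  have hne : V ⊓ (a - algebraMap ℂ (K →L[ℂ] K) c).ker ≠ ⊥ :=
    (Submodule.ne_bot_iff _).2 ⟨v, ⟨v.2, (hmem v).2 hav⟩, fun h => hv.2 (Subtype.ext h)⟩
  have hle := hV.2 ⟨hV.prop.1.inf hker, hne⟩ inf_le_left
  exact ⟨c, fun x hx => (hmem x).1 (hle hx).2⟩

theorem IsMinimalReducing.exists_mul_mul_eq_smul (hV : IsMinimalReducing s V) {a : K →L[ℂ] K}
    (ha : a ∈ StarSubalgebra.centralizer ℂ s) :
    ∃ c : ℂ, V.starProjection * a * V.starProjection = c • V.starProjection := by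
  obtain ⟨c, hc⟩ := hV.exists_forall_mem_apply_eq_smul
    (mul_mem hV.prop.1.starProjection_mem ha)
    fun _ _ => Submodule.starProjection_apply_mem _ _
  exact ⟨c, ContinuousLinearMap.ext fun x => hc _ (Submodule.starProjection_apply_mem V x)⟩

theorem IsMinimalReducing.commutantEquiv (hV : IsMinimalReducing s V)
    (hW : IsMinimalReducing s W) {a : K →L[ℂ] K} (ha : a ∈ StarSubalgebra.centralizer ℂ s)
    (hne : W.starProjection * a * V.starProjection ≠ 0) : CommutantEquiv s V W := by
  have hp : IsStarProjection V.starProjection := isStarProjection_starProjection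
  have hq : IsStarProjection W.starProjection := isStarProjection_starProjection
  have hpC := hV.prop.1.starProjection_mem
  have hqC := hW.prop.1.starProjection_mem
  obtain ⟨t, ht⟩ := hV.exists_mul_mul_eq_smul (mul_mem (mul_mem (star_mem ha) hqC) ha)
  obtain ⟨t', ht'⟩ := hW.exists_mul_mul_eq_smul (mul_mem (mul_mem ha hpC) (star_mem ha))
  set p := V.starProjection
  set q := W.starProjection
  have hstar : star (q * a * p) = p * star a * q := by
    rw [star_mul, star_mul, hp.isSelfAdjoint.star_eq, hq.isSelfAdjoint.star_eq, mul_assoc]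
  obtain ⟨c, hcV, hcW⟩ := exists_smul_star_mul_self_eq (b := q * a * p) (q := q) hp
    (by rw [mul_assoc, hp.isIdempotentElem.eq])
    (by rw [← mul_assoc, ← mul_assoc, hq.isIdempotentElem.eq])
    (t := t) (t' := t')
    (by rw [hstar, ← ht]; simp only [mul_assoc, hq.isIdempotentElem.mul_self_mul])
    (by rw [hstar, ← ht']; simp only [mul_assoc, hp.isIdempotentElem.mul_self_mul])
    hne
  exact ⟨_, SMulMemClass.smul_mem c (mul_mem (mul_mem hqC ha) hpC), hcV, hcW⟩

theorem exists_pairwise_isOrtho_isMinimalReducing (s : Set (K →L[ℂ] K)) :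
    ∃ c : Set (Submodule ℂ K),
      (∀ V ∈ c, IsMinimalReducing s V) ∧ c.Pairwise (· ⟂ ·) ∧ sSup c = ⊤ := by
  obtain ⟨c, hc⟩ := zorn_subset
    {c : Set (Submodule ℂ K) | (∀ V ∈ c, IsMinimalReducing s V) ∧ c.Pairwise (· ⟂ ·)}
    fun C hC hchain => ⟨⋃₀ C, ⟨fun V ⟨c, hcC, hVc⟩ => (hC hcC).1 V hVc,
      (Set.pairwise_sUnion hchain.directedOn).2 fun c hcC => (hC hcC).2⟩,
      fun c hcC => Set.subset_sUnion_of_mem hcC⟩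
  refine ⟨c, hc.prop.1, hc.prop.2, ?_⟩
  by_contra htop
  obtain ⟨V, hVc, hV⟩ := exists_isMinimalReducing_le
    (isReducing_sSup fun V hV => (hc.prop.1 V hV).prop.1).orthogonal
    fun h => htop (Submodule.orthogonal_eq_bot_iff.1 h)
  have hperp (W) (hW : W ∈ c) : V ⟂ W := hVc.trans (Submodule.orthogonal_le (le_sSup hW))
  have hmem : V ∈ c := hc.2 (y := insert V c)
    ⟨Set.forall_mem_insert.2 ⟨hV, hc.prop.1⟩,
      hc.prop.2.insert_of_symm fun W hW _ => hperp W hW⟩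
    (Set.subset_insert V c) (Set.mem_insert V c)
  exact hV.prop.2 (Submodule.isOrtho_self.1 (hperp V hmem))

end Reducing

section Structure

theorem exists_sigma_fin_equiv {α : Type*} [Finite α] (r : Setoid α) :
    ∃ (N : ℕ) (d : Fin N → ℕ) (F : (Σ k, Fin (d k)) ≃ α),
      (∀ k, 0 < d k) ∧ ∀ x y, r (F x) (F y) ↔ x.1 = y.1 := by
  classical
  have := Fintype.ofFinite α
  let e := Fintype.equivFin (Quotient r)
  let cls (k : Fin (Fintype.card (Quotient r))) := {i : α // (⟦i⟧ : Quotient r) = e.symm k}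
  let F : (Σ k, Fin (Fintype.card (cls k))) ≃ α :=
    (Equiv.sigmaCongr e.symm fun k => (Fintype.equivFin (cls k)).symm).trans
      (Equiv.sigmaFiberEquiv (Quotient.mk r))
  have hF (x) : (⟦F x⟧ : Quotient r) = e.symm x.1 :=
    ((Fintype.equivFin (cls x.1)).symm x.2).2
  refine ⟨_, _, F, fun k => ?_, fun x y => ?_⟩
  · obtain ⟨i, hi⟩ := Quotient.exists_rep (e.symm k)
    exact Fintype.card_pos_iff.2 ⟨⟨i, hi⟩⟩
  · rw [← Quotient.eq, hF, hF, e.symm.injective.eq_iff]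

variable {K : Type*} [NormedAddCommGroup K] [InnerProductSpace ℂ K] [CompleteSpace K]
  [FiniteDimensional ℂ K]

/-- An orthogonal decomposition of the space into minimal reducing subspaces of `s`, sorted into
finitely many equivalence classes. The class `k` is represented by `V k`, and its `d k` members are
the ranges of the partial isometries `u ⟨k, a⟩`, which lie in the commutant of `s` and have initial
space `V k`. -/
structure IsotypicFrame (s : Set (K →L[ℂ] K)) where
  classes : ℕ
  d : Fin classes → ℕ
  d_pos : ∀ k, 0 < d k
  V : Fin classes → Submodule ℂ K
  isMinimalReducing : ∀ k, IsMinimalReducing s (V k)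
  eq_of_commutantEquiv : ∀ {k k'}, CommutantEquiv s (V k) (V k') → k = k'
  u : (Σ k, Fin (d k)) → K →L[ℂ] K
  u_mem : ∀ x, u x ∈ StarSubalgebra.centralizer ℂ s
  star_u_mul_u : ∀ x, star (u x) * u x = (V x.1).starProjection
  sum_u_mul_star_u : ∑ x, u x * star (u x) = 1

theorem nonempty_isotypicFrame (s : Set (K →L[ℂ] K)) : Nonempty (IsotypicFrame s) := by
  obtain ⟨c, hmin, hperp, htop⟩ := exists_pairwise_isOrtho_isMinimalReducing s
  have hfam : OrthogonalFamily ℂ (fun i : c => (i : Submodule ℂ K))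
      fun i => (i : Submodule ℂ K).subtypeₗᵢ :=
    OrthogonalFamily.of_pairwise fun i j hij => hperp i.2 j.2 (Subtype.coe_injective.ne hij)
  have : Finite c := WellFoundedGT.finite_of_iSupIndep hfam.independent
    fun i => (hmin i i.2).prop.2
  have := Fintype.ofFinite c
  let r : Setoid c := ⟨fun i j => CommutantEquiv s (i : Submodule ℂ K) j,
    fun i => .refl (hmin i i.2).prop.1, .symm, .trans⟩
  obtain ⟨N, d, F, hd, hF⟩ := exists_sigma_fin_equiv r
  have hequiv (x : Σ k, Fin (d k)) :
      CommutantEquiv s (F ⟨x.1, 0, hd x.1⟩ : Submodule ℂ K) (F x) := (hF _ x).2 rfl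
  choose u hu hinit hfinal using hequiv
  refine ⟨⟨N, d, hd, fun k => F ⟨k, 0, hd k⟩, fun k => hmin _ (F _).2, fun h => (hF _ _).1 h,
    u, hu, hinit, ?_⟩⟩
  ext z
  simp only [hfinal, sum_apply, one_apply_eq_self]
  rw [F.sum_comp fun i => (i : Submodule ℂ K).starProjection z]
  exact hfam.sum_projection_of_mem_iSup z (by rw [← sSup_eq_iSup', htop]; trivial)

namespace IsotypicFrame

variable {s : Set (K →L[ℂ] K)} (S : IsotypicFrame s)

theorem u_mul_starProjection (x) : S.u x * (S.V x.1).starProjection = S.u x :=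
  mul_eq_self_of_star_mul_self_eq isStarProjection_starProjection (S.star_u_mul_u x)

theorem starProjection_mul_star_u (x) :
    (S.V x.1).starProjection * star (S.u x) = star (S.u x) :=
  mul_star_eq_star_of_star_mul_self_eq isStarProjection_starProjection (S.star_u_mul_u x)

theorem star_u_mul_mul_u_mem {X : K →L[ℂ] K} (hX : X ∈ StarSubalgebra.centralizer ℂ s) (x y) :
    star (S.u x) * X * S.u y ∈ StarSubalgebra.centralizer ℂ s :=
  mul_mem (mul_mem (star_mem (S.u_mem x)) hX) (S.u_mem y)

theorem starProjection_mul_mul_starProjection (X : K →L[ℂ] K) (x y) :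
    (S.V x.1).starProjection * (star (S.u x) * X * S.u y) * (S.V y.1).starProjection =
      star (S.u x) * X * S.u y := by
  rw [mul_assoc, mul_assoc _ (S.u y), S.u_mul_starProjection, ← mul_assoc, ← mul_assoc,
    S.starProjection_mul_star_u]

theorem exists_star_u_mul_mul_u_eq_smul {X : K →L[ℂ] K}
    (hX : X ∈ StarSubalgebra.centralizer ℂ s) (k) (a a' : Fin (S.d k)) :
    ∃ c : ℂ, star (S.u ⟨k, a⟩) * X * S.u ⟨k, a'⟩ = c • (S.V k).starProjection := by
  rw [← S.starProjection_mul_mul_starProjection]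
  exact (S.isMinimalReducing k).exists_mul_mul_eq_smul (S.star_u_mul_mul_u_mem hX _ _)

theorem star_u_mul_mul_u_eq_zero {X : K →L[ℂ] K} (hX : X ∈ StarSubalgebra.centralizer ℂ s)
    {x y : Σ k, Fin (S.d k)} (hxy : x.1 ≠ y.1) : star (S.u x) * X * S.u y = 0 := by
  rw [← S.starProjection_mul_mul_starProjection]
  by_contra hne
  exact hxy (S.eq_of_commutantEquiv ((S.isMinimalReducing y.1).commutantEquiv
    (S.isMinimalReducing x.1) (S.star_u_mul_mul_u_mem hX x y) hne)).symm

theorem mem_centralizer_iff_exists_eq_sum {X : K →L[ℂ] K} :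
    X ∈ StarSubalgebra.centralizer ℂ s ↔ ∃ M : ∀ k, Matrix (Fin (S.d k)) (Fin (S.d k)) ℂ,
      ∑ k, ∑ a, ∑ a', M k a a' • (S.u ⟨k, a⟩ * star (S.u ⟨k, a'⟩)) = X := by
  constructor
  · intro hX
    choose M hM using S.exists_star_u_mul_mul_u_eq_smul hX
    refine ⟨fun k => Matrix.of (M k), Eq.symm ?_⟩
    calc X = ∑ x, ∑ y, S.u x * (star (S.u x) * X * S.u y) * star (S.u y) := by
          conv_lhs => rw [← one_mul X, ← mul_one (1 * X), ← S.sum_u_mul_star_u]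
          simp only [Finset.sum_mul, Finset.mul_sum, mul_assoc]
          exact Finset.sum_comm
      _ = _ := by
          simp only [Fintype.sum_sigma]
          refine Finset.sum_congr rfl fun k _ => Finset.sum_congr rfl fun a _ => ?_
          rw [Finset.sum_eq_single_of_mem k (Finset.mem_univ k) fun l _ hl => ?_]
          · simp only [hM, Matrix.of_apply, mul_smul_comm, smul_mul_assoc,
              S.u_mul_starProjection ⟨k, a⟩]
          · simp only [S.star_u_mul_mul_u_eq_zero hX (x := ⟨k, a⟩) (y := ⟨l, _⟩) hl.symm,
              mul_zero, zero_mul, Finset.sum_const_zero]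
  · rintro ⟨M, rfl⟩
    exact sum_mem fun k _ => sum_mem fun a _ => sum_mem fun a' _ =>
      SMulMemClass.smul_mem _ (mul_mem (S.u_mem _) (star_mem (S.u_mem _)))

theorem star_u_mul_u_of_ne {x y : Σ k, Fin (S.d k)} (hxy : x ≠ y) : star (S.u x) * S.u y = 0 := by
  classical
  have hsum : ∑ z, star (star (S.u z) * S.u y) * (star (S.u z) * S.u y) =
      star (S.u y) * S.u y :=
    calc _ = star (S.u y) * (∑ z, S.u z * star (S.u z)) * S.u y := by
          simp only [star_mul, star_star, Finset.sum_mul, Finset.mul_sum, mul_assoc]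
      _ = _ := by rw [S.sum_u_mul_star_u, mul_one]
  have hdiag : star (star (S.u y) * S.u y) * (star (S.u y) * S.u y) = star (S.u y) * S.u y := by
    rw [star_mul, star_star, mul_assoc, S.star_u_mul_u, S.u_mul_starProjection, S.star_u_mul_u]
  rw [← Finset.add_sum_erase _ _ (Finset.mem_univ y), hdiag, add_eq_left,
    Finset.sum_eq_zero_iff_of_nonneg fun _ _ => star_mul_self_nonneg _] at hsum
  exact (CStarRing.star_mul_self_eq_zero_iff _).1
    (hsum x (Finset.mem_erase.2 ⟨hxy, Finset.mem_univ x⟩))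

/-- The image of an orthonormal basis of `V k` under the partial isometries `u ⟨k, a⟩`. -/
def vec (x : Σ k, Fin (S.d k) × Fin (Module.finrank ℂ (S.V k))) : K :=
  S.u ⟨x.1, x.2.1⟩ (stdOrthonormalBasis ℂ (S.V x.1) x.2.2)

theorem orthonormal_vec : Orthonormal ℂ S.vec := by
  classical
  rw [orthonormal_iff_ite]
  rintro ⟨k, a, b⟩ ⟨k', a', b'⟩
  have hinner : inner ℂ (S.vec ⟨k, a, b⟩) (S.vec ⟨k', a', b'⟩) =
      inner ℂ (stdOrthonormalBasis ℂ (S.V k) b : K)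
        ((star (S.u ⟨k, a⟩) * S.u ⟨k', a'⟩) (stdOrthonormalBasis ℂ (S.V k') b')) :=
    (ContinuousLinearMap.adjoint_inner_right _ _ _).symm
  rw [hinner]
  by_cases hx : (⟨k, a⟩ : Σ k, Fin (S.d k)) = ⟨k', a'⟩
  · cases hx
    rw [S.star_u_mul_u, Submodule.starProjection_eq_self_iff.2 (SetLike.coe_mem _),
      ← Submodule.coe_inner, OrthonormalBasis.inner_eq_ite]
    simp
  · rw [S.star_u_mul_u_of_ne hx, zero_apply, inner_zero_right, if_neg]
    rintro ⟨⟩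
    exact hx rfl

theorem sum_rankOne_vec (k) (a a' : Fin (S.d k)) :
    ∑ b, rankOne ℂ (S.vec ⟨k, a, b⟩) (S.vec ⟨k, a', b⟩) =
      S.u ⟨k, a⟩ * star (S.u ⟨k, a'⟩) := by
  rw [← S.u_mul_starProjection, (stdOrthonormalBasis ℂ (S.V k)).starProjection_eq_sum_rankOne,
    Finset.mul_sum, Finset.sum_mul]
  refine Finset.sum_congr rfl fun b _ => ?_
  ext z
  simp [vec, ContinuousLinearMap.star_eq_adjoint, ContinuousLinearMap.adjoint_inner_right]

theorem top_le_span_range_vec : ⊤ ≤ Submodule.span ℂ (Set.range S.vec) := by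
  intro z _
  have hz : z = ∑ x, S.u x (star (S.u x) z) := by
    simpa using (DFunLike.congr_fun S.sum_u_mul_star_u z).symm
  rw [hz]
  refine Submodule.sum_mem _ fun x _ => ?_
  have hx : S.u x (star (S.u x) z) =
      ∑ b, rankOne ℂ (S.vec ⟨x.1, x.2, b⟩) (S.vec ⟨x.1, x.2, b⟩) z := by
    rw [← sum_apply, S.sum_rankOne_vec]
    rfl
  rw [hx]
  exact Submodule.sum_mem _ fun b _ => Submodule.smul_mem _ _ (Submodule.subset_span ⟨_, rfl⟩)

/-- The sector decomposition whose adapted basis is `S.vec`. -/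
def sectorDecomposition : SectorDecomposition K where
  sectors := S.classes
  d := S.d
  n k := Module.finrank ℂ (S.V k)
  d_pos := S.d_pos
  n_pos k := Module.finrank_pos_iff.2
    (Submodule.nontrivial_iff_ne_bot.2 (S.isMinimalReducing k).prop.2)
  U := (OrthonormalBasis.mk S.orthonormal_vec S.top_le_span_range_vec).repr

theorem basis_sectorDecomposition : ⇑S.sectorDecomposition.basis = S.vec :=
  OrthonormalBasis.coe_mk S.orthonormal_vec S.top_le_span_range_vec

theorem sectorDecomposition_op_one (M : ∀ k, Matrix (Fin (S.d k)) (Fin (S.d k)) ℂ) :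
    S.sectorDecomposition.op M 1 =
      ∑ k, ∑ a, ∑ a', M k a a' • (S.u ⟨k, a⟩ * star (S.u ⟨k, a'⟩)) := by
  simp only [← sum_rankOne_vec, ← basis_sectorDecomposition]
  exact S.sectorDecomposition.op_one_right_eq_sum M

end IsotypicFrame

theorem exists_centralizer_eq_blockSet_one (s : Set (K →L[ℂ] K)) :
    ∃ σ : SectorDecomposition K,
      (StarSubalgebra.centralizer ℂ s : Set (K →L[ℂ] K)) = σ.blockSet 1 := by
  obtain ⟨S⟩ := nonempty_isotypicFrame s
  refine ⟨S.sectorDecomposition, Set.ext fun X => ?_⟩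
  simp only [SetLike.mem_coe, S.mem_centralizer_iff_exists_eq_sum, ← S.sectorDecomposition_op_one]
  rfl

end Structure

section Matrix

open Matrix

open scoped MatrixOrder in
theorem exists_sum_star_mul_self_eq_one {m : Type*} [Fintype m] [DecidableEq m] [Nonempty m]
    {τ : Matrix m m ℂ} (hτ : τ.PosSemidef) (htr : τ.trace = Fintype.card m) :
    ∃ g : m × m → Matrix m m ℂ, ∑ p, star (g p) * g p = 1 ∧ ∑ p, g p * star (g p) = τ := by
  have hcard : (Fintype.card m : ℂ) ≠ 0 := Nat.cast_ne_zero.2 Fintype.card_ne_zero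
  obtain ⟨C, hC⟩ : ∃ C, (Fintype.card m : ℂ)⁻¹ • τ = C * star C := by
    have hpos := hτ.smul (inv_nonneg.2 (Nat.cast_nonneg (α := ℂ) (Fintype.card m)))
    obtain ⟨C, hC⟩ := CStarAlgebra.nonneg_iff_eq_star_mul_self.1 hpos.nonneg
    exact ⟨star C, by rw [star_star, hC]⟩
  have hstar (p : m × m) : star (single p.1 p.2 (1 : ℂ)) = single p.2 p.1 1 := by
    rw [star_eq_conjTranspose, conjTranspose_single, star_one]
  refine ⟨fun p => C * single p.1 p.2 1, ?_, ?_⟩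
  · have htrace : ∑ b, (star C * C) b b = 1 := by
      change (star C * C).trace = 1
      rw [trace_mul_comm, ← hC, trace_smul, htr, smul_eq_mul, inv_mul_cancel₀ hcard]
    have hterm (p : m × m) : star (C * single p.1 p.2 1) * (C * single p.1 p.2 1) =
        (star C * C) p.1 p.1 • single p.2 p.2 1 := by
      rw [star_mul, hstar, mul_assoc, ← mul_assoc (star C), ← mul_assoc, single_mul_mul_single,
        one_mul, mul_one, smul_single, smul_eq_mul, mul_one]
    simp only [hterm, Fintype.sum_prod_type, ← Finset.smul_sum, sum_single_one]
    rw [← Finset.sum_smul, htrace, one_smul]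
  · have hterm (p : m × m) : C * single p.1 p.2 1 * star (C * single p.1 p.2 1) =
        C * single p.1 p.1 1 * star C := by
      rw [star_mul, hstar, mul_assoc C, ← mul_assoc (single _ _ _), single_mul_single_same,
        one_mul, ← mul_assoc]
    simp only [hterm, Fintype.sum_prod_type, Finset.sum_const, Finset.card_univ]
    rw [← Finset.smul_sum, ← Finset.sum_mul, ← Finset.mul_sum, sum_single_one, mul_one, ← hC,
      ← Nat.cast_smul_eq_nsmul ℂ, smul_inv_smul₀ hcard]

end Matrix

namespace SectorDecomposition

variable {K : Type*} [NormedAddCommGroup K] [InnerProductSpace ℂ K] [CompleteSpace K]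
  {σ : SectorDecomposition K}

theorem IsDistortionMap.image_blockSet_one {τ : ∀ k, Matrix (Fin (σ.n k)) (Fin (σ.n k)) ℂ}
    {D : (K →L[ℂ] K) →CP (K →L[ℂ] K)} (hD : σ.IsDistortionMap τ D) :
    D '' σ.blockSet 1 = σ.blockSet τ :=
  (Set.range_comp _ _).symm.trans (congrArg Set.range (funext hD.2.2))

variable [FiniteDimensional ℂ K] (σ)

theorem isDistortionMap_krausCP {ι : Type*} [Fintype ι]
    {τ : ∀ k, Matrix (Fin (σ.n k)) (Fin (σ.n k)) ℂ}
    {g : ι → ∀ k, Matrix (Fin (σ.n k)) (Fin (σ.n k)) ℂ} (hone : ∑ i, star (g i) * g i = 1)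
    (hτ : ∑ i, g i * star (g i) = τ) : σ.IsDistortionMap τ (krausCP fun i => σ.op 1 (g i)) := by
  have hsum (M : ∀ k, Matrix (Fin (σ.d k)) (Fin (σ.d k)) ℂ)
      (N : ι → ∀ k, Matrix (Fin (σ.n k)) (Fin (σ.n k)) ℂ) :
      ∑ i, σ.op M (N i) = σ.op M (∑ i, N i) := (map_sum (σ.opBilin M) N Finset.univ).symm
  refine ⟨isTracePreserving_krausMap_iff.2 ?_, fun k => ?_, fun M => ?_⟩
  · simp only [krausMap_apply, Pi.star_apply, star_star, mul_one, star_op, star_one, op_mul_op,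
      hsum, hone, op_one_one]
  · rw [← hτ, Finset.sum_apply]
    exact Matrix.posSemidef_sum _ fun i _ => Matrix.posSemidef_self_mul_conjTranspose (g i k)
  · change krausMap _ _ = _
    simp only [krausMap_apply, star_op, star_one, op_mul_op, one_mul, mul_one, hsum, hτ]

theorem exists_isDistortionMap {τ : ∀ k, Matrix (Fin (σ.n k)) (Fin (σ.n k)) ℂ}
    (hτ : ∀ k, (τ k).PosSemidef) (htr : ∀ k, (τ k).trace = σ.n k) :
    ∃ D, σ.IsDistortionMap τ D := by
  have hblock (k) : ∃ g : Fin (σ.n k) × Fin (σ.n k) → Matrix (Fin (σ.n k)) (Fin (σ.n k)) ℂ,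
      ∑ p, star (g p) * g p = 1 ∧ ∑ p, g p * star (g p) = τ k := by
    have : Nonempty (Fin (σ.n k)) := ⟨0, σ.n_pos k⟩
    exact exists_sum_star_mul_self_eq_one (hτ k) (by rw [htr, Fintype.card_fin])
  choose g hone hτg using hblock
  have hsum (N : ∀ k, Fin (σ.n k) × Fin (σ.n k) → Matrix (Fin (σ.n k)) (Fin (σ.n k)) ℂ) :
      ∑ x : Σ k, Fin (σ.n k) × Fin (σ.n k),
        (Pi.single x.1 (N x.1 x.2) : ∀ k, Matrix (Fin (σ.n k)) (Fin (σ.n k)) ℂ) =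
      fun k => ∑ p, N k p := by
    rw [Fintype.sum_sigma, ← Finset.univ_sum_single fun k => ∑ p, N k p]
    refine Finset.sum_congr rfl fun k _ => ?_
    exact (map_sum (AddMonoidHom.single
      (fun k => Matrix (Fin (σ.n k)) (Fin (σ.n k)) ℂ) k) (N k) Finset.univ).symm
  let G (x : Σ k, Fin (σ.n k) × Fin (σ.n k)) : ∀ k, Matrix (Fin (σ.n k)) (Fin (σ.n k)) ℂ :=
    Pi.single x.1 (g x.1 x.2)
  refine ⟨_, σ.isDistortionMap_krausCP (g := G) ?_ ?_⟩
  · simp only [G, ← Pi.single_star, ← Pi.single_mul, hsum fun k p => star (g k p) * g k p, hone]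
    rfl
  · simp only [G, ← Pi.single_star, ← Pi.single_mul, hsum fun k p => g k p * star (g k p), hτg]

end SectorDecomposition

namespace SectorDecomposition

variable {K : Type*} [NormedAddCommGroup K] [InnerProductSpace ℂ K] [CompleteSpace K]
  (σ : SectorDecomposition K)

theorem posDef_corner {ρ : K →L[ℂ] K} (hρ : IsStrictlyPositive ρ) (a₀ : ∀ k, Fin (σ.d k))
    (k : Fin σ.sectors) : (σ.corner ρ a₀ k).PosDef := by
  obtain ⟨B, rfl⟩ := CStarAlgebra.nonneg_iff_eq_star_mul_self.1 hρ.nonneg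
  have hB : Function.Injective B := fun x y hxy =>
    (ContinuousLinearMap.isUnit_iff_bijective.1 hρ.isUnit).injective
      (congrArg (fun z => star B z) hxy)
  have hgram : σ.corner (star B * B) a₀ k = Matrix.gram ℂ fun b => B (σ.basis ⟨k, a₀ k, b⟩) := by
    ext b b'
    exact ContinuousLinearMap.adjoint_inner_right B _ _
  rw [hgram, Matrix.posDef_gram_iff_linearIndependent]
  have hlin : LinearIndependent ℂ fun b => σ.basis ⟨k, a₀ k, b⟩ :=
    σ.basis.orthonormal.linearIndependent.comp _ fun b b' h => by simpa using h
  exact hlin.map' B.toLinearMap (LinearMap.ker_eq_bot.2 hB)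

variable {ι : Type*} [Fintype ι] {L : ι → K →L[ℂ] K}

theorem op_one_corner_mem_Fix
    (hσ : (StarSubalgebra.centralizer ℂ (Set.range L) : Set (K →L[ℂ] K)) = σ.blockSet 1)
    {ρ : K →L[ℂ] K} (hρ : ρ ∈ Fix (krausMap L)) (a₀ : ∀ k, Fin (σ.d k)) :
    σ.op 1 (σ.corner ρ a₀) ∈ Fix (krausMap L) := by
  have hmem M : σ.op M 1 ∈ StarSubalgebra.centralizer ℂ (Set.range L) :=
    hσ.superset ⟨M, rfl⟩
  rw [op_one_corner]
  refine sum_mem fun k _ => sum_mem fun a _ => ?_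
  rw [mem_Fix, krausMap_mul_right (hmem _), krausMap_mul_left (hmem _), mem_Fix.1 hρ]

theorem op_one_smul_mem_Fix
    (hσ : (StarSubalgebra.centralizer ℂ (Set.range L) : Set (K →L[ℂ] K)) = σ.blockSet 1)
    {N : ∀ k, Matrix (Fin (σ.n k)) (Fin (σ.n k)) ℂ} (hN : σ.op 1 N ∈ Fix (krausMap L))
    (c : Fin σ.sectors → ℂ) (M : ∀ k, Matrix (Fin (σ.d k)) (Fin (σ.d k)) ℂ) :
    σ.op M (fun k => c k • N k) ∈ Fix (krausMap L) := by
  have hmove : σ.op M (fun k => c k • N k) = σ.op (fun k => c k • M k) 1 * σ.op 1 N := by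
    rw [← op_eq_op_one_mul_op_one]
    simp only [op_eq_matrixEquiv, Matrix.smul_kronecker, Matrix.kronecker_smul]
  have hmem : σ.op (fun k => c k • M k) 1 ∈ StarSubalgebra.centralizer ℂ (Set.range L) :=
    hσ.superset ⟨_, rfl⟩
  rw [hmove, mem_Fix, krausMap_mul_left hmem, mem_Fix.1 hN]

variable [FiniteDimensional ℂ K]

theorem Fix_krausMap_eq_blockSet
    (hσ : (Fix (krausMap (star L)) : Set (K →L[ℂ] K)) = σ.blockSet 1)
    {τ : ∀ k, Matrix (Fin (σ.n k)) (Fin (σ.n k)) ℂ} (hτ : ∀ k, τ k ≠ 0)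
    (hfix : σ.blockSet τ ⊆ Fix (krausMap L)) :
    (Fix (krausMap L) : Set (K →L[ℂ] K)) = σ.blockSet τ := by
  have hone k : (1 : Matrix (Fin (σ.n k)) (Fin (σ.n k)) ℂ) ≠ 0 :=
    have : Nonempty (Fin (σ.n k)) := ⟨0, σ.n_pos k⟩
    one_ne_zero
  have hrange : Fix (krausMap (star L)) = (σ.opBilin.flip 1).range := SetLike.coe_injective hσ
  have hle : (σ.opBilin.flip τ).range ≤ Fix (krausMap L) := hfix
  rw [← coe_range_opBilin_flip, ← Submodule.eq_of_le_of_finrank_eq hle]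
  rw [← finrank_Fix_krausMap_star, hrange,
    LinearMap.finrank_range_of_inj (σ.opBilin_flip_injective hτ),
    LinearMap.finrank_range_of_inj (σ.opBilin_flip_injective (N := 1) hone)]

theorem exists_Fix_krausMap_eq_blockSet (hL : krausMap (star L) 1 = 1) {ρ : K →L[ℂ] K}
    (hρ : IsStrictlyPositive ρ) (hfix : ρ ∈ Fix (krausMap L))
    (hσ : (StarSubalgebra.centralizer ℂ (Set.range L) : Set (K →L[ℂ] K)) = σ.blockSet 1) :
    ∃ τ : ∀ k, Matrix (Fin (σ.n k)) (Fin (σ.n k)) ℂ,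
      (∀ k, (τ k).PosSemidef) ∧ (∀ k, (τ k).trace = σ.n k) ∧
        (Fix (krausMap L) : Set (K →L[ℂ] K)) = σ.blockSet τ := by
  have hn k : (σ.n k : ℂ) ≠ 0 := Nat.cast_ne_zero.2 (σ.n_pos k).ne'
  have hne k : Nonempty (Fin (σ.n k)) := ⟨0, σ.n_pos k⟩
  let a₀ (k : Fin σ.sectors) : Fin (σ.d k) := ⟨0, σ.d_pos k⟩
  let c (k : Fin σ.sectors) : ℂ := σ.n k / (σ.corner ρ a₀ k).trace
  have htr_pos k : 0 < (σ.corner ρ a₀ k).trace := (σ.posDef_corner hρ a₀ k).trace_pos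
  have htr k : (c k • σ.corner ρ a₀ k).trace = σ.n k := by
    rw [Matrix.trace_smul, smul_eq_mul, div_mul_cancel₀ _ (htr_pos k).ne']
  have hτ k : c k • σ.corner ρ a₀ k ≠ 0 := fun h => hn k <| by
    rw [← htr k, h, Matrix.trace_zero]
  have hsub : σ.blockSet (fun k => c k • σ.corner ρ a₀ k) ⊆ Fix (krausMap L) := by
    rintro _ ⟨M, rfl⟩
    exact σ.op_one_smul_mem_Fix hσ (σ.op_one_corner_mem_Fix hσ hfix a₀) c M
  refine ⟨fun k => c k • σ.corner ρ a₀ k, fun k => ?_, htr, ?_⟩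
  · exact (σ.posDef_corner hρ a₀ k).posSemidef.smul
      (div_nonneg (Nat.cast_nonneg _) (htr_pos k).le)
  · refine σ.Fix_krausMap_eq_blockSet ?_ hτ hsub
    rw [Fix_krausMap_star_eq_centralizer hL hρ hfix, hσ]

end SectorDecomposition

theorem exists_sectorDecomposition_of_isStrictlyPositive {K ι : Type*} [NormedAddCommGroup K]
    [InnerProductSpace ℂ K] [CompleteSpace K] [FiniteDimensional ℂ K] [Fintype ι]
    {L : ι → K →L[ℂ] K} (hL : krausMap (star L) 1 = 1) {ρ : K →L[ℂ] K}
    (hρ : IsStrictlyPositive ρ) (hfix : ρ ∈ Fix (krausMap L)) :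
    ∃ (A : StarSubalgebra ℂ (K →L[ℂ] K)) (σ : SectorDecomposition K)
      (τ : ∀ k, Matrix (Fin (σ.n k)) (Fin (σ.n k)) ℂ) (D : (K →L[ℂ] K) →CP (K →L[ℂ] K)),
      (A : Set (K →L[ℂ] K)) = Fix (krausMap (star L)) ∧ (A : Set (K →L[ℂ] K)) = σ.blockSet 1 ∧
        σ.IsDistortionMap τ D ∧ (Fix (krausMap L) : Set (K →L[ℂ] K)) = σ.blockSet τ := by
  obtain ⟨σ, hσ⟩ := exists_centralizer_eq_blockSet_one (Set.range L)
  obtain ⟨τ, hτ, htr, hFix⟩ := σ.exists_Fix_krausMap_eq_blockSet hL hρ hfix hσ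
  obtain ⟨D, hD⟩ := σ.exists_isDistortionMap hτ htr
  exact ⟨.centralizer ℂ (Set.range L), σ, τ, D,
    (Fix_krausMap_star_eq_centralizer hL hρ hfix).symm, hσ, hD, hFix⟩

end QChannel

end

theorem mainTheorem2 {H : Type*} [NormedAddCommGroup H] [InnerProductSpace ℂ H]
    [FiniteDimensional ℂ H] [CompleteSpace H]
    (E : (H →L[ℂ] H) →CP (H →L[ℂ] H)) (hE : QChannel.IsTracePreserving E.toLinearMap)
    (P₀ : Submodule ℂ H) (hP₀ : P₀ = QChannel.support (QChannel.Fix E.toLinearMap : Set (H →L[ℂ] H))) :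
    QChannel.IsInvariantSubspace E.toLinearMap P₀ ∧
    ∃ (A : StarSubalgebra ℂ (P₀ →L[ℂ] P₀)) (σ : QChannel.SectorDecomposition P₀)
      (τ : ∀ k, Matrix (Fin (σ.n k)) (Fin (σ.n k)) ℂ)
      (D : (P₀ →L[ℂ] P₀) →CP (P₀ →L[ℂ] P₀)),
      (A : Set (P₀ →L[ℂ] P₀)) =
        QChannel.Fix (QChannel.hsAdjoint (QChannel.restrict E.toLinearMap P₀)) ∧
      (A : Set (P₀ →L[ℂ] P₀)) = σ.blockSet 1 ∧
      σ.IsDistortionMap τ D ∧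
      (QChannel.Fix E.toLinearMap : Set (H →L[ℂ] H)) = QChannel.embed P₀ '' (D '' A) ∧
      (QChannel.Fix E.toLinearMap : Set (H →L[ℂ] H)) = QChannel.embed P₀ '' σ.blockSet τ ∧
      QChannel.sandwich P₀ '' (QChannel.Fix (QChannel.hsAdjoint E.toLinearMap) : Set (H →L[ℂ] H)) =
        QChannel.embed P₀ '' A := by
  open QChannel in
  obtain ⟨n, K, hEK⟩ := exists_krausMap_eq E
  rw [hEK] at hE hP₀ ⊢
  obtain ⟨ρ, hρfix, hρ, hρP⟩ := exists_nonneg_mem_Fix_range_eq_support (krausMap_monotone K) hE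
  obtain rfl : ρ.range = P₀ := hρP.trans hP₀.symm
  have hK i x : x ∈ ρ.range → K i x ∈ ρ.range := apply_mem_range_of_mem_Fix_krausMap hρ hρfix i
  have hinv := isInvariantSubspace_krausMap hK
  have hsupp X (hX : X ∈ Fix (krausMap K)) : sandwich ρ.range X = X :=
    hP₀ ▸ sandwich_support_eq_self hX
  have hK1 := isTracePreserving_krausMap_iff.1 hE
  have hL1 : krausMap (star fun i => compress ρ.range (K i)) 1 = 1 := by
    rw [← compress_one, krausMap_star_compress hK, hK1]
  have hρ₀ := compress_mem_Fix_restrict hρfix (hsupp ρ hρfix)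
  have hFix := Fix_eq_map_embed hinv hsupp
  rw [restrict_krausMap] at hρ₀ hFix ⊢
  obtain ⟨A, σ, τ, D, hA, hAσ, hD, hτ⟩ :=
    exists_sectorDecomposition_of_isStrictlyPositive hL1 (isStrictlyPositive_compress_range hρ) hρ₀
  rw [hsAdjoint_krausMap, hsAdjoint_krausMap]
  refine ⟨hinv, A, σ, τ, D, hA, hAσ, hD, ?_, ?_, ?_⟩
  · rw [hAσ, hD.image_blockSet_one, hFix, Submodule.map_coe, hτ]
  · rw [hFix, Submodule.map_coe, hτ]
  · rw [hA, ← map_compress_Fix_krausMap_star hK1 hK hsupp, Submodule.map_coe, Set.image_image]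
    rfl
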